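/- **Theorem 2.1.** Let $X$ be a random variable with $\mathbb E X=0$ and $\operatorname{Var}(X)=1$ which is strictly subgaussian, that is, $\mathbb E e^{tX}\le e^{t^2/2}$ (with the left side finite) for all $t\in\mathbb R$. Put $A(t)=\frac{t^2}{2}-\log \mathbb E e^{tX}$, $t\in\mathbb R$, so that $A\ge 0$. Let $X_1,X_2,\dots$ be independent copies of $X$, and let $Z_n=(X_1+\dots+X_n)/\sqrt n$. Let $\varphi$ be the standard normal density on $\mathbb R$, and for a probability density $p$ on $\mathbb R$ let $$T_\infty(p\|\varphi)=\operatorname*{ess\,sup}_{x\in\mathbb R}\frac{p(x)-\varphi(x)}{\varphi(x)}\in[0,\infty].$$ Assume that for some $n\ge 1$ the random variable $Z_n$ has a density $p_n$ with respect to Lebesgue measure such that $T_\infty(p_n\|\varphi)<\infty$. Then the following are equivalent. 1. For all sufficiently large $n$ the random variable $Z_n$ has a density $p_n$, and $T_\infty(p_n\|\varphi)\to 0$ as $n\to\infty$. 2. Both of the following conditions hold: (a) $A''(t)=0$ for every $t\in\mathbb R$ with $A(t)=0$; (b) $\limsup_{k\to\infty}A''(t_k)\le 0$ for every real sequence $(t_k)$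 with $t_k\to+\infty$ or $t_k\to-\infty$ such that $A(t_k)\to 0$ as $k\to\infty$. -/

import Mathlib

open MeasureTheory ProbabilityTheory Filter Topology

noncomputable section

/-- The Tsallis distance of infinite order to the standard normal density `φ`:
`T_∞(p‖φ) = ess sup_x (p x - φ x) / φ x` (Lebesgue essential supremum), an extended real. -/
def tsallisInf (p : ℝ → ℝ) : EReal :=
  essSup (fun x : ℝ =>
    (((p x - gaussianPDFReal 0 1 x) / gaussianPDFReal 0 1 x : ℝ) : EReal)) volume

/-- Strict subgaussianity of a (centered) random variable: `exp (t X)` is integrable and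
`E exp (t X) ≤ exp (σ² t² / 2)` for every real `t`, where `σ²` is the variance of `X`. -/
def StrictlySubgaussian {Ω : Type*} [MeasurableSpace Ω] (X : Ω → ℝ) (P : Measure Ω) : Prop :=
  HasSubgaussianMGF X (variance X P).toNNReal P

/-- The function `A(t) = t² / 2 - log E exp (t X)`. -/
def logLaplaceGap {Ω : Type*} [MeasurableSpace Ω] (X : Ω → ℝ) (P : Measure Ω) (t : ℝ) : ℝ :=
  t ^ 2 / 2 - cgf X P t

/-- The normalized sum `Z_n` of the first `n` terms of the sequence `ξ`. -/
def normalizedSum {Ω : Type*} (ξ : ℕ → Ω → ℝ) (n : ℕ) (ω : Ω) : ℝ :=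
  (∑ k ∈ Finset.range n, ξ k ω) / Real.sqrt n

/-- The density of a real random variable with respect to Lebesgue measure, as a real function.
It is the density in the usual sense when `HasPDF Z P volume` holds. -/
def realDensity {Ω : Type*} [MeasurableSpace Ω] (Z : Ω → ℝ) (P : Measure Ω) (x : ℝ) : ℝ :=
  (pdf Z P volume x).toReal

end

/-!
# Convergence of normalized sums to the normal law in the Tsallis distance of infinite order

Write `μ` for the law of `X`, `A` for the gap function and `Sₙ` for the sum of `n` copies. Tilting
`μ` by `exp (t x)` and evaluating the density of `Sₙ` at `n t` gives the exact identity
(`densityRatio_eq`)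

  `pₙ (√n t) / φ (√n t) = √(2πn) · exp (-n A t) · (2π)⁻¹ ∫ (exp (-i u t) · fₜ u) ^ n du`,

where `fₜ` is the characteristic function of the tilted law. The tilted law has mean `t - A' t` and
variance `1 - A'' t`, so a local limit theorem suggests that the ratio is about
`exp (-n A t) · (1 - A'' t) ^ (-1/2) · exp (-n (A' t)² / (2 (1 - A'' t)))`. The point is that this
holds with an error that is uniform over all `t` with `A t ≤ 1` (`exists_densityRatio_sub_le`).

* The hypothesis that some `pₘ` is at most a multiple of `φ` makes the density of the tilted `Sₘ`
  bounded by `C exp (m A t)` (`tilted_convPow_le`), so that Plancherel bounds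
  `∫ |fₜ| ^ (2m)`.
* This bound and a third moment bound, which follows from `0 ≤ A` and `(A')² ≤ 2 A`, are all that
  the local limit theorem needs (`exists_integral_norm_centeredCharFun_pow_sub_le`): they bound the
  variance from below and separate `|fₜ|` from `1` away from the origin
  (`exists_normSq_charFun_le_one_sub`).
* The same Plancherel bound shows that the ratio decays exponentially where `A t` is bounded below
  (`densityRatio_le`).

Since the densities are continuous for `n ≥ 2m`, the Tsallis distance is the supremum of the ratio
minus one. By the above it tends to `0` exactly when `A''` is uniformly small from above wherever
`A` is small (`SmallGapCondition`), and a compactness argument identifies this condition with the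
two conditions of the theorem; at zeros of `A`, which are minima, `A'' ≥ 0` is automatic.
-/

open scoped NNReal

/-! ### Fourier inversion -/

section

open scoped FourierTransform

open scoped ContDiff in
/-- Fourier inversion for an integrable function without continuity assumption. -/
theorem fourierInv_fourier_ae_eq {f : ℝ → ℂ} (hf : Integrable f) (h : Integrable (𝓕 f)) :
    𝓕⁻ (𝓕 f) =ᵐ[volume] f := by
  have hneg : Continuous fun p : ℝ × ℝ => (-innerₗ ℝ : ℝ →ₗ[ℝ] ℝ →ₗ[ℝ] ℝ) p.1 p.2 :=
    (continuous_inner (𝕜 := ℝ) (E := ℝ)).neg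
  have hcont : Continuous (𝓕⁻ (𝓕 f)) := by
    have := VectorFourier.fourierIntegral_continuous (L := -innerₗ ℝ) (μ := volume)
      Real.continuous_fourierChar hneg h
    exact this
  refine ae_eq_of_integral_contDiff_smul_eq hcont.locallyIntegrable hf.locallyIntegrable ?_
  intro g hg hgc
  have hgc' : HasCompactSupport (fun x => (g x : ℂ)) := hgc.comp_left Complex.ofReal_zero
  have hg' : ContDiff ℝ ∞ (fun x => (g x : ℂ)) := Complex.ofRealCLM.contDiff.comp hg
  let G : SchwartzMap ℝ ℂ := hgc'.toSchwartzMap hg'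
  have hG : ∀ x, G x = (g x : ℂ) := fun x => rfl
  have e1 : ∫ x, (𝓕⁻ G) x • (𝓕 f) x = ∫ x, (G x) • (𝓕⁻ (𝓕 f)) x := by
    have := VectorFourier.integral_fourierIntegral_smul_eq_flip (L := -innerₗ ℝ) (μ := volume)
      (ν := volume) (f := G) (g := 𝓕 f)
      Real.continuous_fourierChar hneg
      G.integrable h
    have e : (-innerₗ ℝ : ℝ →ₗ[ℝ] ℝ →ₗ[ℝ] ℝ).flip = -innerₗ ℝ := by
      ext; simp
    rw [e] at this
    rw [SchwartzMap.fourierInv_coe]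
    exact this
  have e2 : ∫ x, (𝓕 (𝓕⁻ G)) x • f x = ∫ x, (𝓕⁻ G) x • (𝓕 f) x := by
    have := VectorFourier.integral_fourierIntegral_smul_eq_flip (L := innerₗ ℝ) (μ := volume)
      (ν := volume) (f := ⇑(𝓕⁻ G : SchwartzMap ℝ ℂ)) (g := f)
      Real.continuous_fourierChar (by simpa using (continuous_inner (𝕜 := ℝ) (E := ℝ)))
      (𝓕⁻ G).integrable hf
    have e : (innerₗ ℝ : ℝ →ₗ[ℝ] ℝ →ₗ[ℝ] ℝ).flip = innerₗ ℝ := by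
      ext; simp
    rw [e] at this
    rw [SchwartzMap.fourier_coe]
    exact this
  simp only [FourierTransform.fourier_fourierInv_eq, hG, smul_eq_mul] at e1 e2
  simp only [Complex.real_smul]
  rw [← e1, e2]

/-- Inversion formula: an absolutely continuous law with integrable characteristic function has
the inverse Fourier transform of the latter as density. -/
theorem rnDeriv_ae_eq_integral_charFun {ρ : Measure ℝ} [IsFiniteMeasure ρ] (hac : ρ ≪ volume)
    (h : Integrable (charFun ρ)) :
    ∀ᵐ x : ℝ, (((ρ.rnDeriv volume x).toReal : ℝ) : ℂ) =
      (2 * Real.pi)⁻¹ * ∫ u : ℝ, Complex.exp (-(u * x * Complex.I)) * charFun ρ u := by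
  set r : ℝ → ℝ := fun x => (ρ.rnDeriv volume x).toReal with hr
  have hri : Integrable r := Measure.integrable_toReal_rnDeriv
  have hpi := Real.pi_pos
  have hF : ∀ w, 𝓕 (fun x => (r x : ℂ)) w = charFun ρ (-(2 * Real.pi) * w) := by
    intro w
    rw [charFun_apply_real, Real.fourier_real_eq_integral_exp_smul,
      ← integral_rnDeriv_smul hac]
    congr 1; ext x
    simp only [hr, smul_eq_mul, Complex.real_smul]
    rw [mul_comm]
    congr 2
    push_cast
    ring
  have hFi : Integrable (𝓕 (fun x => (r x : ℂ))) := by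
    rw [show 𝓕 (fun x => (r x : ℂ)) = fun w => charFun ρ (-(2 * Real.pi) * w) from funext hF]
    exact h.comp_mul_left' (by simp [hpi.ne'])
  filter_upwards [fourierInv_fourier_ae_eq hri.ofReal hFi] with x hx
  have hx' : 𝓕⁻ (𝓕 (fun x => ((r x : ℝ) : ℂ))) x = ((r x : ℝ) : ℂ) := hx
  refine Eq.trans hx'.symm ?_
  rw [Real.fourierInv_eq]
  have e : ∀ w : ℝ, Real.fourierChar (inner ℝ w x) • 𝓕 (fun x => (r x : ℂ)) w =
      (fun u : ℝ => Complex.exp (-(u * x * Complex.I)) * charFun ρ u) (-(2 * Real.pi) * w) := by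
    intro w
    rw [hF, Circle.smul_def, Real.fourierChar_apply]
    simp only [smul_eq_mul]
    congr 2
    simp
    ring
  rw [integral_congr_ae (ae_of_all _ e), Measure.integral_comp_mul_left
    (fun u : ℝ => Complex.exp (-(u * x * Complex.I)) * charFun ρ u) (-(2 * Real.pi))]
  simp [abs_of_pos hpi]

end

/-! ### Plancherel inequality for laws with bounded density -/

/-- The law of `X - Y` for `X`, `Y` independent with law `ν`. -/
noncomputable def symmetrization (ν : Measure ℝ) : Measure ℝ := ν ∗ ν.map (fun x => -x)

instance isProbabilityMeasure_symmetrization (ν : Measure ℝ) [IsProbabilityMeasure ν] :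
    IsProbabilityMeasure (symmetrization ν) := by
  have : IsProbabilityMeasure (ν.map (fun x => -x)) :=
    Measure.isProbabilityMeasure_map (by fun_prop)
  unfold symmetrization; infer_instance

theorem charFun_symmetrization (ν : Measure ℝ) [IsProbabilityMeasure ν] (u : ℝ) :
    charFun (symmetrization ν) u = ((‖charFun ν u‖ ^ 2 : ℝ) : ℂ) := by
  have : IsProbabilityMeasure (ν.map (fun x => -x)) :=
    Measure.isProbabilityMeasure_map (by fun_prop)
  have h : charFun (ν.map (fun x => -x)) u = charFun ν (-u) := by
    have := charFun_map_mul (μ := ν) (-1) u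
    simpa using this
  rw [symmetrization, charFun_conv, h, charFun_neg, Complex.mul_conj, Complex.normSq_eq_norm_sq]

theorem symmetrization_le {ν : Measure ℝ} [IsProbabilityMeasure ν] {M : ENNReal}
    (h : ν ≤ M • volume) : symmetrization ν ≤ M • volume := by
  have : IsProbabilityMeasure (ν.map (fun x => -x)) :=
    Measure.isProbabilityMeasure_map (by fun_prop)
  rw [symmetrization, Measure.conv_comm]
  refine Measure.le_iff.2 fun s hs => ?_
  rw [← lintegral_indicator_one hs, Measure.lintegral_conv (by measurability)]
  calc _ ≤ ∫⁻ x, (M • volume) s ∂(ν.map (fun x => -x)) := by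
        refine lintegral_mono fun x => ?_
        calc _ ≤ ∫⁻ y, s.indicator 1 (x + y) ∂(M • volume : Measure ℝ) :=
              lintegral_mono' h le_rfl
          _ = _ := by
            rw [lintegral_smul_measure, lintegral_add_left_eq_self (fun y => s.indicator 1 y),
              lintegral_indicator_one hs]
            simp
    _ = _ := by simp

/-- Multiplication formula for the characteristic functions of two finite measures. -/
theorem integral_charFun_comm (τ γ : Measure ℝ) [IsFiniteMeasure τ] [IsFiniteMeasure γ] :
    ∫ u, charFun τ u ∂γ = ∫ x, charFun γ x ∂τ := by
  simp_rw [charFun_apply_real]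
  rw [integral_integral_swap]
  · congr 1; ext x; congr 1; ext u; congr 1; ring
  · refine Integrable.of_bound (C := 1) (by fun_prop) (ae_of_all _ fun p => ?_)
    simp only [Function.uncurry]
    rw [← Complex.ofReal_mul, Complex.norm_exp_ofReal_mul_I]

/-- Gaussian regularization of Plancherel's inequality: the integral equals, up to a constant, that
of a Gaussian against the symmetrization, whose density is bounded by `M` as well. -/
theorem integral_normSq_charFun_mul_gaussian_le {ν : Measure ℝ} [IsProbabilityMeasure ν] {M : ℝ}
    (hM : 0 ≤ M) (h : ν ≤ ENNReal.ofReal M • volume) {v : ℝ≥0} (hv : v ≠ 0) :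
    ∫ u, ‖charFun ν u‖ ^ 2 * Real.exp (-u ^ 2 / (2 * v)) ≤ 2 * Real.pi * M := by
  have hv0 : (0 : ℝ) < v := by positivity
  have key := integral_charFun_comm (symmetrization ν) (gaussianReal 0 v)
  simp_rw [charFun_symmetrization, charFun_gaussianReal] at key
  have e1 : ∀ x : ℝ, Complex.exp (x * (0 : ℝ) * Complex.I - v * x ^ 2 / 2) =
      ((Real.exp (-(v / 2) * x ^ 2) : ℝ) : ℂ) := by
    intro x; push_cast; congr 1; ring
  simp_rw [e1] at key
  rw [integral_complex_ofReal, integral_complex_ofReal, Complex.ofReal_inj] at key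
  rw [integral_gaussianReal_eq_integral_smul hv] at key
  have e2 : ∀ u : ℝ, gaussianPDFReal 0 v u • ‖charFun ν u‖ ^ 2 =
      (√(2 * Real.pi * v))⁻¹ * (‖charFun ν u‖ ^ 2 * Real.exp (-u ^ 2 / (2 * v))) := by
    intro u; simp only [gaussianPDFReal, smul_eq_mul, sub_zero]; ring
  simp_rw [e2] at key
  rw [integral_const_mul] at key
  have hle : ∫ x, Real.exp (-(v / 2) * x ^ 2) ∂(symmetrization ν) ≤
      M * √(Real.pi / (v / 2)) := by
    have hg : Integrable (fun x : ℝ => Real.exp (-((v : ℝ) / 2) * x ^ 2)) :=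
      integrable_exp_neg_mul_sq (by positivity)
    calc _ ≤ ∫ x, Real.exp (-(v / 2) * x ^ 2) ∂(ENNReal.ofReal M • volume : Measure ℝ) := by
          refine integral_mono_measure (symmetrization_le h) ?_ ?_
          · exact ae_of_all _ fun x => by positivity
          · exact hg.smul_measure (by simp)
      _ = _ := by
        rw [integral_smul_measure, integral_gaussian, ENNReal.toReal_ofReal hM, smul_eq_mul]
  have hs : 0 < √(2 * Real.pi * v) := by positivity
  rw [inv_mul_eq_iff_eq_mul₀ hs.ne'] at key
  rw [key]
  calc _ ≤ √(2 * Real.pi * v) * (M * √(Real.pi / (v / 2))) := by gcongr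
    _ = M * √(2 * Real.pi * v * (Real.pi / (v / 2))) := by
      rw [Real.sqrt_mul (by positivity) (Real.pi / (v / 2))]; ring
    _ = M * √((2 * Real.pi) ^ 2) := by congr 2; field_simp
    _ = _ := by rw [Real.sqrt_sq (by positivity)]; ring

/-- Plancherel inequality for a law with density bounded by `M`. -/
theorem lintegral_normSq_charFun_le {ν : Measure ℝ} [IsProbabilityMeasure ν] {M : ℝ}
    (hM : 0 ≤ M) (h : ν ≤ ENNReal.ofReal M • volume) :
    ∫⁻ u, ENNReal.ofReal (‖charFun ν u‖ ^ 2) ≤ ENNReal.ofReal (2 * Real.pi * M) := by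
  have hmeas : Measurable (charFun ν) := measurable_charFun
  let F : ℕ → ℝ → ENNReal := fun k u =>
    ENNReal.ofReal (‖charFun ν u‖ ^ 2 * Real.exp (-u ^ 2 / (2 * ((k + 1 : ℝ≥0) : ℝ))))
  have hF : ∀ k, ∫⁻ u, F k u ≤ ENNReal.ofReal (2 * Real.pi * M) := by
    intro k
    rw [← ofReal_integral_eq_lintegral_ofReal]
    · exact ENNReal.ofReal_le_ofReal (integral_normSq_charFun_mul_gaussian_le hM h (by positivity))
    · have hg : Integrable (fun u : ℝ => Real.exp (-(2 * ((k + 1 : ℝ≥0) : ℝ))⁻¹ * u ^ 2)) :=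
        integrable_exp_neg_mul_sq (by positivity)
      refine hg.mono' (by fun_prop) (ae_of_all _ fun u => ?_)
      rw [Real.norm_of_nonneg (by positivity)]
      have : ‖charFun ν u‖ ^ 2 ≤ 1 := pow_le_one₀ (norm_nonneg _) (norm_charFun_le_one u)
      calc _ ≤ 1 * Real.exp (-u ^ 2 / (2 * ((k + 1 : ℝ≥0) : ℝ))) := by gcongr
        _ = _ := by rw [one_mul]; congr 1; ring
    · exact ae_of_all _ fun u => by positivity
  have hlim : ∀ u, Tendsto (fun k => F k u) atTop (𝓝 (ENNReal.ofReal (‖charFun ν u‖ ^ 2))) := by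
    intro u
    refine ENNReal.tendsto_ofReal ?_
    have h1 : Tendsto (fun k : ℕ => -u ^ 2 / (2 * ((k + 1 : ℝ≥0) : ℝ))) atTop (𝓝 0) := by
      refine Tendsto.div_atTop tendsto_const_nhds ?_
      refine Tendsto.const_mul_atTop (by norm_num) ?_
      push_cast
      exact tendsto_atTop_add_const_right _ _ tendsto_natCast_atTop_atTop
    have h2 := (Real.continuous_exp.tendsto 0).comp h1
    simpa using h2.const_mul (‖charFun ν u‖ ^ 2)
  calc ∫⁻ u, ENNReal.ofReal (‖charFun ν u‖ ^ 2) = ∫⁻ u, liminf (fun k => F k u) atTop := by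
        congr 1; ext u; exact (hlim u).liminf_eq.symm
    _ ≤ liminf (fun k => ∫⁻ u, F k u) atTop := lintegral_liminf_le (fun k => by fun_prop)
    _ ≤ _ := by
      refine (liminf_le_liminf (Eventually.of_forall hF)).trans ?_
      simp

theorem integrable_normSq_charFun {ν : Measure ℝ} [IsProbabilityMeasure ν] {M : ℝ}
    (hM : 0 ≤ M) (h : ν ≤ ENNReal.ofReal M • volume) :
    Integrable (fun u => ‖charFun ν u‖ ^ 2) := by
  have hmeas : Measurable (charFun ν) := measurable_charFun
  refine ⟨by fun_prop, ?_⟩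
  rw [hasFiniteIntegral_iff_ofReal (ae_of_all _ fun u => by positivity)]
  exact (lintegral_normSq_charFun_le hM h).trans_lt ENNReal.ofReal_lt_top

theorem integral_normSq_charFun_le {ν : Measure ℝ} [IsProbabilityMeasure ν] {M : ℝ}
    (hM : 0 ≤ M) (h : ν ≤ ENNReal.ofReal M • volume) :
    ∫ u, ‖charFun ν u‖ ^ 2 ≤ 2 * Real.pi * M := by
  have := lintegral_normSq_charFun_le hM h
  rwa [← ofReal_integral_eq_lintegral_ofReal (integrable_normSq_charFun hM h)
    (ae_of_all _ fun u => by positivity), ENNReal.ofReal_le_ofReal_iff (by positivity)] at this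

/-! ### Separation of characteristic functions from one -/

theorem abs_sin_natCast_mul_le (k : ℕ) (x : ℝ) : |Real.sin (k * x)| ≤ k * |Real.sin x| := by
  induction k with
  | zero => simp
  | succ k ih =>
    push_cast
    rw [add_mul, one_mul, Real.sin_add]
    calc _ ≤ |Real.sin (k * x)| * |Real.cos x| + |Real.cos (k * x)| * |Real.sin x| := by
          rw [← abs_mul, ← abs_mul]; exact abs_add_le _ _
      _ ≤ |Real.sin (k * x)| * 1 + 1 * |Real.sin x| := by
          gcongr <;> exact Real.abs_cos_le_one _
      _ ≤ _ := by linarith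

theorem one_sub_cos_eq_two_mul_sin_sq (x : ℝ) : 1 - Real.cos x = 2 * Real.sin (x / 2) ^ 2 := by
  have h1 := Real.cos_two_mul (x / 2)
  have h2 := Real.sin_sq_add_cos_sq (x / 2)
  rw [show 2 * (x / 2) = x by ring] at h1
  linarith

theorem one_sub_cos_natCast_mul_le (k : ℕ) (x : ℝ) :
    1 - Real.cos (k * x) ≤ k ^ 2 * (1 - Real.cos x) := by
  rw [one_sub_cos_eq_two_mul_sin_sq, one_sub_cos_eq_two_mul_sin_sq x, mul_div_assoc,
    ← sq_abs (Real.sin (k * (x / 2))), ← sq_abs (Real.sin (x / 2))]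
  have := abs_sin_natCast_mul_le k (x / 2)
  calc _ ≤ 2 * (k * |Real.sin (x / 2)|) ^ 2 := by gcongr
    _ = _ := by ring

theorem one_sub_cos_add_le (x y : ℝ) :
    1 - Real.cos (x + y) ≤ 2 * (1 - Real.cos x) + 2 * (1 - Real.cos y) := by
  have h : |Real.sin ((x + y) / 2)| ≤ |Real.sin (x / 2)| + |Real.sin (y / 2)| := by
    rw [add_div, Real.sin_add]
    calc _ ≤ |Real.sin (x / 2)| * |Real.cos (y / 2)| + |Real.cos (x / 2)| * |Real.sin (y / 2)| := by
          rw [← abs_mul, ← abs_mul]; exact abs_add_le _ _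
      _ ≤ |Real.sin (x / 2)| * 1 + 1 * |Real.sin (y / 2)| := by
          gcongr <;> exact Real.abs_cos_le_one _
      _ ≤ _ := by linarith
  simp only [one_sub_cos_eq_two_mul_sin_sq]
  rw [← sq_abs (Real.sin ((x + y) / 2)), ← sq_abs (Real.sin (x / 2)),
    ← sq_abs (Real.sin (y / 2))]
  nlinarith [abs_nonneg (Real.sin ((x + y) / 2)),
    sq_nonneg (|Real.sin (x / 2)| - |Real.sin (y / 2)|),
    pow_le_pow_left₀ (abs_nonneg (Real.sin ((x + y) / 2))) h 2]

theorem integrable_cos_mul (τ : Measure ℝ) [IsFiniteMeasure τ] (u : ℝ) :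
    Integrable (fun x => Real.cos (u * x)) τ :=
  Integrable.of_bound (C := 1) (by fun_prop) (ae_of_all _ fun x => Real.abs_cos_le_one _)

/-- As `‖charFun ν‖ ^ 2` is the characteristic function of a symmetric law, trigonometric
inequalities for `1 - cos` carry over to `1 - ‖charFun ν‖ ^ 2`. -/
theorem one_sub_normSq_charFun_eq (ν : Measure ℝ) [IsProbabilityMeasure ν] (u : ℝ) :
    1 - ‖charFun ν u‖ ^ 2 = ∫ x, (1 - Real.cos (u * x)) ∂(symmetrization ν) := by
  have h := congrArg Complex.re (charFun_symmetrization ν u)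
  rw [Complex.ofReal_re, charFun_apply_real] at h
  have hi : Integrable (fun x : ℝ => Complex.exp (u * x * Complex.I)) (symmetrization ν) :=
    Integrable.of_bound (C := 1) (by fun_prop) (ae_of_all _ fun x => by
      rw [← Complex.ofReal_mul, Complex.norm_exp_ofReal_mul_I])
  rw [integral_sub (integrable_const _) (integrable_cos_mul _ u), ← h]
  have h2 := integral_re hi
  simp only [RCLike.re_eq_complex_re] at h2
  rw [← h2]
  simp [← Complex.ofReal_mul, Complex.exp_ofReal_mul_I_re]

theorem one_sub_normSq_charFun_natCast_mul_le (ν : Measure ℝ) [IsProbabilityMeasure ν] (k : ℕ)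
    (u : ℝ) : 1 - ‖charFun ν (k * u)‖ ^ 2 ≤ k ^ 2 * (1 - ‖charFun ν u‖ ^ 2) := by
  rw [one_sub_normSq_charFun_eq, one_sub_normSq_charFun_eq, ← integral_const_mul]
  refine integral_mono ?_ ?_ fun x => ?_
  · exact (integrable_const _).sub (integrable_cos_mul _ _)
  · exact ((integrable_const _).sub (integrable_cos_mul _ _)).const_mul _
  · simpa only [mul_assoc] using one_sub_cos_natCast_mul_le k (u * x)

theorem one_sub_normSq_charFun_add_le (ν : Measure ℝ) [IsProbabilityMeasure ν] (u v : ℝ) :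
    1 - ‖charFun ν (u + v)‖ ^ 2 ≤
      2 * (1 - ‖charFun ν u‖ ^ 2) + 2 * (1 - ‖charFun ν v‖ ^ 2) := by
  simp only [one_sub_normSq_charFun_eq]
  rw [← integral_const_mul, ← integral_const_mul, ← integral_add]
  · refine integral_mono ?_ ?_ fun x => ?_
    · exact (integrable_const _).sub (integrable_cos_mul _ _)
    · exact (((integrable_const _).sub (integrable_cos_mul _ _)).const_mul _).add
        (((integrable_const _).sub (integrable_cos_mul _ _)).const_mul _)
    · simpa only [add_mul] using one_sub_cos_add_le (u * x) (v * x)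
  · exact ((integrable_const _).sub (integrable_cos_mul _ _)).const_mul _
  · exact ((integrable_const _).sub (integrable_cos_mul _ _)).const_mul _

/-- Uniform separation of `|charFun ν|` from `1` away from the origin, with a gap that depends
only on a bound for an integral of a power of it and on a Lipschitz constant at the origin.
If `|charFun ν u|` were nearly `1`, so it would be near many multiples of `u`, and the integral
would be large. -/
theorem exists_normSq_charFun_le_one_sub {a L C : ℝ} (ha : 0 < a) (hL : 0 < L) (m : ℕ) :
    ∃ η : ℝ, 0 < η ∧ η < 1 ∧ ∀ (ν : Measure ℝ) [IsProbabilityMeasure ν],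
      (∀ v, 1 - ‖charFun ν v‖ ^ 2 ≤ L * |v|) →
      Integrable (fun u => (‖charFun ν u‖ ^ 2) ^ m) → ∫ u, (‖charFun ν u‖ ^ 2) ^ m ≤ C →
      ∀ u, a ≤ |u| → ‖charFun ν u‖ ^ 2 ≤ 1 - η := by
  set r : ℝ := min (a / 4) (1 / (8 * L)) with hr
  have hr0 : 0 < r := by positivity
  have hra : r ≤ a / 4 := min_le_left _ _
  have hrL : L * r ≤ 1 / 8 := by
    calc L * r ≤ L * (1 / (8 * L)) := by gcongr; exact min_le_right _ _
      _ = 1 / 8 := by field_simp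
  -- `N` disjoint intervals of length `2 r` on which the integrand is at least `2 ^ (-m)` would
  -- exceed the bound `C`
  obtain ⟨N, hN⟩ := exists_nat_gt (2 ^ m * C / (2 * r))
  refine ⟨1 / (8 * (N + 1) ^ 2), by positivity, ?_, ?_⟩
  · rw [div_lt_one (by positivity)]
    nlinarith [(Nat.cast_nonneg N : (0 : ℝ) ≤ N)]
  intro ν _ hLip hint hC u hu
  by_contra! hlt
  have hgap : 1 - ‖charFun ν u‖ ^ 2 ≤ 1 / (8 * (N + 1) ^ 2) := by linarith
  have hball : ∀ k ∈ Finset.range N, ∀ w ∈ Metric.closedBall (k * u) r,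
      1 / 2 ≤ ‖charFun ν w‖ ^ 2 := by
    intro k hk w hw
    have hkN : (k : ℝ) ≤ N + 1 := by
      have := Finset.mem_range.1 hk
      have : (k : ℝ) < N := by exact_mod_cast this
      linarith
    have h1 := one_sub_normSq_charFun_natCast_mul_le ν k u
    have h2 := one_sub_normSq_charFun_add_le ν (k * u) (w - k * u)
    rw [add_sub_cancel] at h2
    have h3 := hLip (w - k * u)
    have h4 : L * |w - k * u| ≤ L * r := by
      gcongr
      simpa [Real.dist_eq] using hw
    have h5 : (k : ℝ) ^ 2 * (1 - ‖charFun ν u‖ ^ 2) ≤ 1 / 8 := by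
      calc _ ≤ ((N : ℝ) + 1) ^ 2 * (1 / (8 * (N + 1) ^ 2)) := by
            have : ‖charFun ν u‖ ^ 2 ≤ 1 := pow_le_one₀ (norm_nonneg _) (norm_charFun_le_one u)
            have : 0 ≤ 1 - ‖charFun ν u‖ ^ 2 := by linarith
            gcongr
        _ = 1 / 8 := by field_simp
    linarith
  have hdisj : Set.PairwiseDisjoint (↑(Finset.range N))
      (fun k : ℕ => Metric.closedBall ((k : ℝ) * u) r) := by
    intro k _ l _ hkl
    refine Metric.closedBall_disjoint_closedBall ?_
    rw [Real.dist_eq, ← sub_mul, abs_mul]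
    have h1 : (1 : ℝ) ≤ |(k : ℝ) - l| := by
      have : (k : ℤ) - l ≠ 0 := by omega
      have h := Int.one_le_abs this
      exact_mod_cast h
    nlinarith [abs_nonneg u]
  have hvol : (volume (⋃ k ∈ Finset.range N, Metric.closedBall ((k : ℝ) * u) r)).toReal =
      N * (2 * r) := by
    rw [measure_biUnion_finset hdisj (fun _ _ => measurableSet_closedBall)]
    simp only [Real.volume_closedBall, Finset.sum_const, Finset.card_range, nsmul_eq_mul]
    rw [ENNReal.toReal_mul, ENNReal.toReal_ofReal (by positivity)]
    simp
  set S := ⋃ k ∈ Finset.range N, Metric.closedBall ((k : ℝ) * u) r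
  have hSm : MeasurableSet S := Finset.measurableSet_biUnion _ fun _ _ => measurableSet_closedBall
  have hSfin : volume S ≠ ⊤ := by
    refine ((measure_biUnion_finset_le _ _).trans_lt ?_).ne
    simp only [Real.volume_closedBall, Finset.sum_const, nsmul_eq_mul]
    exact ENNReal.mul_lt_top (ENNReal.natCast_lt_top _) ENNReal.ofReal_lt_top
  have h1 : (1 / 2) ^ m * (N * (2 * r)) ≤ C := by
    calc _ = ∫ w in S, ((1 / 2) ^ m : ℝ) := by
          rw [setIntegral_const, Measure.real, hvol, smul_eq_mul]; ring
      _ ≤ ∫ w in S, (‖charFun ν w‖ ^ 2) ^ m := by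
          refine setIntegral_mono_on (by simp [hSfin.lt_top]) hint.integrableOn hSm ?_
          intro w hw
          simp only [S, Set.mem_iUnion] at hw
          obtain ⟨k, hk, hw⟩ := hw
          exact pow_le_pow_left₀ (by norm_num) (hball k hk w hw) m
      _ ≤ ∫ w, (‖charFun ν w‖ ^ 2) ^ m :=
          setIntegral_le_integral hint (ae_of_all _ fun w => by positivity)
      _ ≤ C := hC
  rw [div_lt_iff₀ (by positivity)] at hN
  have h2 : (2 : ℝ) ^ m * ((1 / 2) ^ m * (N * (2 * r))) ≤ 2 ^ m * C := by gcongr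
  rw [← mul_assoc, ← mul_pow] at h2
  norm_num at h2
  linarith

/-! ### Powers of functions close to a Gaussian -/

theorem norm_pow_sub_pow_le_of_norm_le {x y : ℂ} {q : ℝ} (hx : ‖x‖ ≤ q) (hy : ‖y‖ ≤ q) (n : ℕ) :
    ‖x ^ n - y ^ n‖ ≤ n * q ^ (n - 1) * ‖x - y‖ := by
  have hq : 0 ≤ q := (norm_nonneg x).trans hx
  rw [← Commute.geom_sum₂_mul (Commute.all x y) n, norm_mul]
  gcongr
  calc _ ≤ ∑ i ∈ Finset.range n, ‖x ^ i * y ^ (n - 1 - i)‖ := norm_sum_le _ _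
    _ ≤ ∑ i ∈ Finset.range n, q ^ (n - 1) := by
        refine Finset.sum_le_sum fun i hi => ?_
        have hi' := Finset.mem_range.1 hi
        rw [norm_mul, norm_pow, norm_pow]
        calc _ ≤ q ^ i * q ^ (n - 1 - i) := by gcongr
          _ = _ := by rw [← pow_add]; congr 1; omega
    _ = _ := by simp

theorem tendsto_sqrt_mul_pow_sub {θ : ℝ} (h0 : 0 < θ) (h1 : θ < 1) (N : ℕ) :
    Tendsto (fun n : ℕ => √n * θ ^ (n - N)) atTop (𝓝 0) := by
  have h := (tendsto_self_mul_const_pow_of_lt_one h0.le h1).mul_const ((θ ^ N)⁻¹)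
  rw [zero_mul] at h
  refine squeeze_zero' (Eventually.of_forall fun n => by positivity) ?_ h
  filter_upwards [eventually_ge_atTop N, eventually_ge_atTop 1] with n hn hn1
  rw [pow_sub₀ _ h0.ne' hn, ← mul_assoc]
  have hn1' : (1 : ℝ) ≤ n := by exact_mod_cast hn1
  gcongr
  rw [Real.sqrt_le_left (by positivity)]
  nlinarith

theorem integrable_abs_cube_mul_exp {b : ℝ} (hb : 0 < b) :
    Integrable (fun w : ℝ => |w| ^ 3 * Real.exp (-b * w ^ 2)) := by
  have h := (integrable_rpow_mul_exp_neg_mul_sq hb (s := 3) (by norm_num)).norm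
  refine h.congr (ae_of_all _ fun w => ?_)
  simp only [norm_mul, Real.norm_eq_abs, Real.abs_exp]
  congr 1
  rw [show (3 : ℝ) = ((3 : ℕ) : ℝ) by norm_num, Real.rpow_natCast, abs_pow]

/-- Rescaling `u` by `√n`, the source of the rate `n ^ (-1/2)` in the local limit theorem. -/
theorem integral_abs_cube_mul_exp_scale (b : ℝ) {n : ℕ} (hn : 0 < n) :
    √n * ∫ u : ℝ, n * (|u| ^ 3 * Real.exp (-b * n * u ^ 2)) =
      (∫ w : ℝ, |w| ^ 3 * Real.exp (-b * w ^ 2)) / √n := by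
  have hn0 : (0 : ℝ) < n := by exact_mod_cast hn
  have hs : 0 < √(n : ℝ) := by positivity
  have hss : √(n : ℝ) ^ 2 = n := Real.sq_sqrt hn0.le
  have e : ∀ u : ℝ, (n : ℝ) * (|u| ^ 3 * Real.exp (-b * n * u ^ 2)) =
      (√(n : ℝ))⁻¹ * (fun w : ℝ => |w| ^ 3 * Real.exp (-b * w ^ 2)) (√n * u) := by
    intro u
    simp only [abs_mul, abs_of_pos hs, mul_pow, hss]
    rw [show √(n : ℝ) ^ 3 = n * √n by rw [pow_succ, hss]]
    field_simp
  simp_rw [integral_congr_ae (ae_of_all _ e)]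
  rw [integral_const_mul, Measure.integral_comp_mul_left
    (fun w : ℝ => |w| ^ 3 * Real.exp (-b * w ^ 2))]
  rw [abs_of_pos (by positivity), smul_eq_mul]
  field_simp

/-- Comparison of `n`-th powers near the origin, where both `z` and the Gaussian factor are at most
`exp (-v₀ u² / 8)`. -/
theorem norm_pow_sub_exp_pow_le_of_abs_le {v₀ V K a v u : ℝ} {z : ℂ} {n : ℕ} (hv₀ : 0 < v₀)
    (ha1 : a ≤ 1) (haK : K * a ≤ v₀ / 8) (haV : V * a ≤ 1) (hvv : v₀ ≤ v) (hvV : v ≤ V)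
    (hu : |u| ≤ a) (hz : ‖z - (Real.exp (-(v / 2) * u ^ 2) : ℝ)‖ ≤ K * |u| ^ 3) (hn : 2 ≤ n) :
    ‖z ^ n - ((Real.exp (-(v / 2) * u ^ 2) : ℝ) : ℂ) ^ n‖ ≤
      K * (n * (|u| ^ 3 * Real.exp (-(v₀ / 16) * n * u ^ 2))) := by
  have hv : 0 < v := hv₀.trans_le hvv
  have hu2 : u ^ 2 = |u| ^ 2 := (sq_abs u).symm
  have hu2' : |u| ^ 2 ≤ |u| := by nlinarith [abs_nonneg u]
  have hcub : K * |u| ^ 3 ≤ v₀ / 8 * u ^ 2 := by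
    rw [hu2]
    have h0 := norm_nonneg (z - (Real.exp (-(v / 2) * u ^ 2) : ℝ))
    rcases (abs_nonneg u).eq_or_lt with h | h
    · simp [← h]
    · have hK : 0 ≤ K := by
        by_contra! hK
        have : K * |u| ^ 3 < 0 := mul_neg_of_neg_of_pos hK (by positivity)
        linarith
      calc K * |u| ^ 3 = K * |u| * |u| ^ 2 := by ring
        _ ≤ K * a * |u| ^ 2 := by gcongr
        _ ≤ v₀ / 8 * |u| ^ 2 := by gcongr
  have hx1 : v * u ^ 2 ≤ 1 := by
    rw [hu2]
    calc v * |u| ^ 2 ≤ V * a := mul_le_mul hvV (hu2'.trans hu) (by positivity) (by linarith)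
      _ ≤ 1 := haV
  have hvu : 0 ≤ v * u ^ 2 := by positivity
  have hv0u : v₀ * u ^ 2 ≤ v * u ^ 2 := by gcongr
  have hv0u' : 0 ≤ v₀ * u ^ 2 := by positivity
  have hexp : Real.exp (-(v / 2) * u ^ 2) ≤ 1 - v / 4 * u ^ 2 := by
    have h1 := Real.abs_exp_sub_one_sub_id_le (x := -(v / 2) * u ^ 2) (by
      rw [abs_le]; constructor <;> linarith)
    have h2 := (abs_le.1 h1).2
    have h3 : (-(v / 2) * u ^ 2) ^ 2 = (v * u ^ 2) * (v * u ^ 2) / 4 := by ring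
    have h4 : (v * u ^ 2) * (v * u ^ 2) ≤ 1 * (v * u ^ 2) := by gcongr
    linarith
  have hq : (1 : ℝ) - v₀ / 8 * u ^ 2 ≤ Real.exp (-(v₀ / 8) * u ^ 2) := by
    have := Real.add_one_le_exp (-(v₀ / 8) * u ^ 2)
    linarith
  have hgn : ‖((Real.exp (-(v / 2) * u ^ 2) : ℝ) : ℂ)‖ = Real.exp (-(v / 2) * u ^ 2) := by
    rw [Complex.norm_real, Real.norm_of_nonneg (Real.exp_pos _).le]
  have hyq : ‖((Real.exp (-(v / 2) * u ^ 2) : ℝ) : ℂ)‖ ≤ Real.exp (-(v₀ / 8) * u ^ 2) := by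
    rw [hgn]; linarith
  have hxq : ‖z‖ ≤ Real.exp (-(v₀ / 8) * u ^ 2) := by
    have h1 : ‖z‖ ≤ ‖((Real.exp (-(v / 2) * u ^ 2) : ℝ) : ℂ)‖ +
        ‖z - (Real.exp (-(v / 2) * u ^ 2) : ℝ)‖ := by
      rw [← sub_le_iff_le_add']; exact norm_sub_norm_le _ _
    rw [hgn] at h1
    linarith
  have hpow : Real.exp (-(v₀ / 8) * u ^ 2) ^ (n - 1) ≤ Real.exp (-(v₀ / 16) * n * u ^ 2) := by
    rw [← Real.exp_nat_mul]
    apply Real.exp_le_exp.2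
    have h2 : (n : ℝ) / 2 ≤ ((n - 1 : ℕ) : ℝ) := by
      rw [Nat.cast_sub (by omega)]
      have : (2 : ℝ) ≤ n := by exact_mod_cast hn
      push_cast; linarith
    have := mul_le_mul_of_nonneg_right h2 hv0u'
    linarith
  calc _ ≤ _ := norm_pow_sub_pow_le_of_norm_le hxq hyq n
    _ ≤ n * Real.exp (-(v₀ / 16) * n * u ^ 2) * (K * |u| ^ 3) := by gcongr
    _ = _ := by ring

/-- Comparison of `n`-th powers away from the origin, where both are exponentially small; `N` powers
of `‖z‖` and one of the Gaussian are kept for integrability. -/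
theorem norm_pow_sub_exp_pow_le_of_le_abs {v₀ a v u θ : ℝ} {z : ℂ} {n N : ℕ} (hv₀ : 0 < v₀)
    (ha : 0 ≤ a) (hvv : v₀ ≤ v) (hu : a ≤ |u|) (hz : ‖z‖ ≤ θ) (hnN : N ≤ n) (hn : 1 ≤ n) :
    ‖z ^ n - ((Real.exp (-(v / 2) * u ^ 2) : ℝ) : ℂ) ^ n‖ ≤ θ ^ (n - N) * ‖z‖ ^ N +
      Real.exp (-(v₀ / 2) * a ^ 2) ^ (n - 1) * Real.exp (-(v₀ / 2) * u ^ 2) := by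
  have h1 : ‖z ^ n‖ ≤ θ ^ (n - N) * ‖z‖ ^ N := by
    calc ‖z ^ n‖ = ‖z‖ ^ (n - N) * ‖z‖ ^ N := by
          rw [norm_pow, ← pow_add]; congr 1; omega
      _ ≤ _ := by gcongr
  have hgle : Real.exp (-(v / 2) * u ^ 2) ≤ Real.exp (-(v₀ / 2) * u ^ 2) := by
    have : v₀ * u ^ 2 ≤ v * u ^ 2 := by gcongr
    exact Real.exp_le_exp.2 (by linarith)
  have h2 : ‖((Real.exp (-(v / 2) * u ^ 2) : ℝ) : ℂ) ^ n‖ ≤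
      Real.exp (-(v₀ / 2) * a ^ 2) ^ (n - 1) * Real.exp (-(v₀ / 2) * u ^ 2) := by
    rw [norm_pow, Complex.norm_real, Real.norm_of_nonneg (Real.exp_pos _).le]
    have hb : Real.exp (-(v₀ / 2) * u ^ 2) ≤ Real.exp (-(v₀ / 2) * a ^ 2) := by
      have : a ^ 2 ≤ u ^ 2 := by rw [← sq_abs u]; gcongr
      have : v₀ * a ^ 2 ≤ v₀ * u ^ 2 := by gcongr
      exact Real.exp_le_exp.2 (by linarith)
    calc _ ≤ Real.exp (-(v₀ / 2) * u ^ 2) ^ n := by gcongr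
      _ = Real.exp (-(v₀ / 2) * u ^ 2) ^ (n - 1) * Real.exp (-(v₀ / 2) * u ^ 2) := by
        rw [← pow_succ]; congr 1; omega
      _ ≤ _ := by gcongr
  exact (norm_sub_le _ _).trans (add_le_add h1 h2)

/-- Quantitative local limit theorem on the level of Fourier transforms: `h ^ n` is close in `L¹`
to the `n`-th power of the Gaussian factor `exp (-v u² / 2)`, with an error that depends only on
the constants. Near the origin the cubic approximation is used, away from it both factors decay
exponentially. -/
theorem exists_integral_norm_pow_sub_pow_le {v₀ V K C : ℝ} (hv₀ : 0 < v₀) (hV : 0 < V)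
    (hK : 0 < K) (N : ℕ) :
    ∃ a : ℝ, 0 < a ∧ ∀ η : ℝ, 0 < η → η < 1 → ∃ E : ℕ → ℝ, Tendsto E atTop (𝓝 0) ∧
      ∀ (h : ℝ → ℂ) (v : ℝ), Measurable h → v₀ ≤ v → v ≤ V →
      (∀ u, |u| ≤ 1 → ‖h u - (Real.exp (-(v / 2) * u ^ 2) : ℝ)‖ ≤ K * |u| ^ 3) →
      (∀ u, ‖h u‖ ≤ 1) → (∀ u, a ≤ |u| → ‖h u‖ ^ 2 ≤ 1 - η) →
      Integrable (fun u => ‖h u‖ ^ N) → ∫ u, ‖h u‖ ^ N ≤ C →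
      ∀ n : ℕ, 2 ≤ n → N ≤ n →
        Integrable (fun u => h u ^ n) ∧
        √n * ∫ u, ‖h u ^ n - ((Real.exp (-(v / 2) * u ^ 2) : ℝ) : ℂ) ^ n‖ ≤ E n := by
  -- for `|u| ≤ a` the cubic error is absorbed by the quadratic decay and `v u² ≤ 1`
  set a : ℝ := min 1 (min (v₀ / (8 * K)) (1 / V)) with ha
  have ha0 : 0 < a := by positivity
  have ha1 : a ≤ 1 := min_le_left _ _
  have haK : K * a ≤ v₀ / 8 := by
    calc K * a ≤ K * (v₀ / (8 * K)) := by
          gcongr; exact (min_le_right _ _).trans (min_le_left _ _)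
      _ = v₀ / 8 := by field_simp
  have haV : V * a ≤ 1 := by
    calc V * a ≤ V * (1 / V) := by
          gcongr; exact (min_le_right _ _).trans (min_le_right _ _)
      _ = 1 := by field_simp
  refine ⟨a, ha0, fun η hη hη1 => ?_⟩
  set θ : ℝ := √(1 - η) with hθ
  have hθ0 : 0 < θ := Real.sqrt_pos.2 (by linarith)
  have hθ1 : θ < 1 := by
    rw [hθ, Real.sqrt_lt' one_pos]; linarith
  set β : ℝ := Real.exp (-(v₀ / 2) * a ^ 2) with hβ
  have hβ0 : 0 < β := Real.exp_pos _
  have hβ1 : β < 1 := Real.exp_lt_one_iff.2 (by nlinarith [mul_pos hv₀ (pow_pos ha0 2)])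
  set J : ℝ := ∫ w : ℝ, |w| ^ 3 * Real.exp (-(v₀ / 16) * w ^ 2) with hJ
  set G : ℝ := ∫ u : ℝ, Real.exp (-(v₀ / 2) * u ^ 2) with hG
  refine ⟨fun n => K * (J / √n) + √n * θ ^ (n - N) * C + √n * β ^ (n - 1) * G, ?_, ?_⟩
  · have t1 : Tendsto (fun n : ℕ => K * (J / √n)) atTop (𝓝 0) := by
      have : Tendsto (fun n : ℕ => J / √(n : ℝ)) atTop (𝓝 0) :=
        tendsto_const_nhds.div_atTop
          (Real.tendsto_sqrt_atTop.comp tendsto_natCast_atTop_atTop)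
      simpa using this.const_mul K
    have t2 := (tendsto_sqrt_mul_pow_sub hθ0 hθ1 N).mul_const C
    have t3 := (tendsto_sqrt_mul_pow_sub hβ0 hβ1 1).mul_const G
    simpa using (t1.add t2).add t3
  intro h v hm hvv hvV hTay hone hgap hint hC n hn2 hnN
  have hhn : Integrable (fun u => h u ^ n) := by
    refine hint.mono' (by fun_prop) (ae_of_all _ fun u => ?_)
    rw [norm_pow]
    exact pow_le_pow_of_le_one (norm_nonneg _) (hone u) hnN
  refine ⟨hhn, ?_⟩
  have hGi : Integrable (fun u : ℝ => Real.exp (-(v₀ / 2) * u ^ 2)) :=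
    integrable_exp_neg_mul_sq (by positivity)
  have hJi : Integrable (fun u : ℝ => (n : ℝ) * (|u| ^ 3 * Real.exp (-(v₀ / 16) * n * u ^ 2))) := by
    have := (integrable_abs_cube_mul_exp (b := v₀ / 16 * n) (by positivity)).const_mul (n : ℝ)
    simpa only [neg_mul] using this
  have hpt : ∀ u : ℝ, ‖h u ^ n - ((Real.exp (-(v / 2) * u ^ 2) : ℝ) : ℂ) ^ n‖ ≤
      K * (n * (|u| ^ 3 * Real.exp (-(v₀ / 16) * n * u ^ 2))) + θ ^ (n - N) * ‖h u‖ ^ N +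
        β ^ (n - 1) * Real.exp (-(v₀ / 2) * u ^ 2) := by
    intro u
    have p2 : 0 ≤ θ ^ (n - N) * ‖h u‖ ^ N := by positivity
    have p3 : 0 ≤ β ^ (n - 1) * Real.exp (-(v₀ / 2) * u ^ 2) := by positivity
    have p1 : 0 ≤ K * (n * (|u| ^ 3 * Real.exp (-(v₀ / 16) * n * u ^ 2))) := by positivity
    rcases le_total |u| a with hu | hu
    · have := norm_pow_sub_exp_pow_le_of_abs_le hv₀ ha1 haK haV hvv hvV hu
        (hTay u (hu.trans ha1)) hn2
      linarith
    · have h1 := norm_pow_sub_exp_pow_le_of_le_abs (N := N) hv₀ ha0.le hvv hu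
        (Real.le_sqrt_of_sq_le (hgap u hu)) hnN (by omega)
      linarith
  have hi1 : Integrable (fun u : ℝ => K * (n * (|u| ^ 3 * Real.exp (-(v₀ / 16) * n * u ^ 2)))) :=
    hJi.const_mul K
  have hi2 : Integrable (fun u : ℝ => θ ^ (n - N) * ‖h u‖ ^ N) := hint.const_mul _
  have hi3 : Integrable (fun u : ℝ => β ^ (n - 1) * Real.exp (-(v₀ / 2) * u ^ 2)) :=
    hGi.const_mul _
  have hi12 : Integrable (fun u : ℝ => K * (n * (|u| ^ 3 * Real.exp (-(v₀ / 16) * n * u ^ 2))) +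
      θ ^ (n - N) * ‖h u‖ ^ N) := hi1.add hi2
  have hle : ∫ u, ‖h u ^ n - ((Real.exp (-(v / 2) * u ^ 2) : ℝ) : ℂ) ^ n‖ ≤
      K * (∫ u : ℝ, n * (|u| ^ 3 * Real.exp (-(v₀ / 16) * n * u ^ 2))) +
        θ ^ (n - N) * (∫ u, ‖h u‖ ^ N) + β ^ (n - 1) * G := by
    rw [← integral_const_mul, ← integral_const_mul, hG, ← integral_const_mul,
      ← integral_add hi1 hi2, ← integral_add hi12 hi3]
    exact integral_mono_of_nonneg (ae_of_all _ fun u => norm_nonneg _)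
      (hi12.add hi3) (ae_of_all _ hpt)
  have hsc := integral_abs_cube_mul_exp_scale (v₀ / 16) (n := n) (by omega)
  rw [← hJ] at hsc
  calc _ ≤ √(n : ℝ) * (K * (∫ u : ℝ, n * (|u| ^ 3 * Real.exp (-(v₀ / 16) * n * u ^ 2))) +
        θ ^ (n - N) * (∫ u, ‖h u‖ ^ N) + β ^ (n - 1) * G) := by gcongr
    _ ≤ √(n : ℝ) * (K * (∫ u : ℝ, n * (|u| ^ 3 * Real.exp (-(v₀ / 16) * n * u ^ 2))) +
        θ ^ (n - N) * C + β ^ (n - 1) * G) := by gcongr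
    _ = K * (√(n : ℝ) * ∫ u : ℝ, n * (|u| ^ 3 * Real.exp (-(v₀ / 16) * n * u ^ 2))) +
        √n * θ ^ (n - N) * C + √n * β ^ (n - 1) * G := by ring
    _ = _ := by rw [hsc]

/-! ### Uniform local limit theorem -/

theorem norm_exp_mul_I_sub_taylor_le (y : ℝ) :
    ‖Complex.exp (y * Complex.I) - (1 + y * Complex.I - y ^ 2 / 2)‖ ≤ 4 * |y| ^ 3 := by
  rcases le_total |y| 1 with hy | hy
  · have h := Complex.norm_exp_sub_sum_le_norm_mul_exp (y * Complex.I) 3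
    have e : ∑ m ∈ Finset.range 3, ((y : ℂ) * Complex.I) ^ m / (m.factorial : ℂ) =
        1 + y * Complex.I - y ^ 2 / 2 := by
      simp [Finset.sum_range_succ, mul_pow, Nat.factorial]
      ring
    rw [e] at h
    have hn : ‖(y : ℂ) * Complex.I‖ = |y| := by simp
    rw [hn] at h
    have : Real.exp |y| ≤ 4 := by
      have := Real.exp_one_lt_d9
      have := Real.exp_le_exp.2 hy
      linarith
    calc _ ≤ _ := h
      _ ≤ |y| ^ 3 * 4 := by gcongr
      _ = _ := by ring
  · have h1 : |y| ≤ |y| ^ 3 := le_self_pow₀ hy (by norm_num)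
    have h2 : |y| ^ 2 ≤ |y| ^ 3 := pow_le_pow_right₀ hy (by norm_num)
    have hn : ‖(y : ℂ) * Complex.I‖ = |y| := by simp
    have hn2 : ‖(y : ℂ) ^ 2 / 2‖ = |y| ^ 2 / 2 := by simp
    calc _ ≤ ‖Complex.exp (y * Complex.I)‖ + (‖(1 : ℂ)‖ + ‖(y : ℂ) * Complex.I‖ +
          ‖(y : ℂ) ^ 2 / 2‖) := by
          refine (norm_sub_le _ _).trans ?_
          gcongr
          exact (norm_sub_le _ _).trans (by gcongr; exact norm_add_le _ _)
      _ = 1 + (1 + |y| + |y| ^ 2 / 2) := by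
          rw [Complex.norm_exp_ofReal_mul_I, norm_one, hn, hn2]
      _ ≤ _ := by linarith

theorem abs_exp_neg_sub_one_add_le {x : ℝ} (hx : 0 ≤ x) : |Real.exp (-x) - (1 - x)| ≤ x ^ 2 := by
  have h1 := Real.add_one_le_exp (-x)
  have h2 : Real.exp (-x) * (1 + x) ≤ 1 := by
    have := Real.add_one_le_exp x
    calc Real.exp (-x) * (1 + x) ≤ Real.exp (-x) * Real.exp x := by gcongr; linarith
      _ = 1 := by rw [← Real.exp_add]; simp
  rw [abs_of_nonneg (by linarith)]
  nlinarith [Real.exp_pos (-x), pow_nonneg hx 3]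

/-- Characteristic function of the law `ν` translated by `-b`. -/
noncomputable def centeredCharFun (ν : Measure ℝ) (b u : ℝ) : ℂ :=
  Complex.exp (-(u * b * Complex.I)) * charFun ν u

theorem norm_centeredCharFun (ν : Measure ℝ) (b u : ℝ) :
    ‖centeredCharFun ν b u‖ = ‖charFun ν u‖ := by
  rw [centeredCharFun, norm_mul, ← Complex.ofReal_mul, ← neg_mul, ← Complex.ofReal_neg,
    Complex.norm_exp_ofReal_mul_I, one_mul]

theorem measurable_centeredCharFun (ν : Measure ℝ) [IsFiniteMeasure ν] (b : ℝ) :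
    Measurable (centeredCharFun ν b) := by
  have : Measurable (charFun ν) := measurable_charFun
  unfold centeredCharFun
  fun_prop

theorem centeredCharFun_eq_integral (ν : Measure ℝ) (b u : ℝ) :
    centeredCharFun ν b u = ∫ x, Complex.exp ((u * (x - b) : ℝ) * Complex.I) ∂ν := by
  rw [centeredCharFun, charFun_apply_real, ← integral_const_mul]
  congr 1; ext x
  rw [← Complex.exp_add]
  congr 1; push_cast; ring

theorem integrable_exp_mul_sub_mul_I (ν : Measure ℝ) [IsFiniteMeasure ν] (b u : ℝ) :
    Integrable (fun x : ℝ => Complex.exp ((u * (x - b) : ℝ) * Complex.I)) ν :=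
  Integrable.of_bound (C := 1) (by fun_prop) (ae_of_all _ fun x => by
      rw [Complex.norm_exp_ofReal_mul_I])

theorem one_sub_normSq_charFun_le_sq_mul {ν : Measure ℝ} [IsProbabilityMeasure ν] {b : ℝ}
    (h2 : Integrable (fun x => (x - b) ^ 2) ν) (u : ℝ) :
    1 - ‖charFun ν u‖ ^ 2 ≤ u ^ 2 * ∫ x, (x - b) ^ 2 ∂ν := by
  have hre : (centeredCharFun ν b u).re = ∫ x, Real.cos (u * (x - b)) ∂ν := by
    rw [centeredCharFun_eq_integral]
    have := integral_re (integrable_exp_mul_sub_mul_I ν b u)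
    simp only [RCLike.re_eq_complex_re] at this
    rw [← this]
    simp only [Complex.exp_ofReal_mul_I_re]
  have hlow : 1 - u ^ 2 / 2 * ∫ x, (x - b) ^ 2 ∂ν ≤ (centeredCharFun ν b u).re := by
    rw [hre]
    calc _ = ∫ x, (1 - u ^ 2 / 2 * (x - b) ^ 2) ∂ν := by
          rw [integral_sub (integrable_const _) (h2.const_mul _), integral_const_mul]
          simp
      _ ≤ _ := by
          refine integral_mono ((integrable_const _).sub (h2.const_mul _)) ?_ fun x => ?_
          · exact Integrable.of_bound (C := 1) (by fun_prop)
              (ae_of_all _ fun x => Real.abs_cos_le_one _)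
          · have := Real.one_sub_sq_div_two_le_cos (x := u * (x - b))
            dsimp only
            linarith
  have h1 := Complex.re_le_norm (centeredCharFun ν b u)
  rw [norm_centeredCharFun] at h1
  have h3 := norm_charFun_le_one (μ := ν) u
  nlinarith [norm_nonneg (charFun ν u)]

theorem sq_le_one_add_abs_cube (y : ℝ) : y ^ 2 ≤ 1 + |y| ^ 3 := by
  rw [← sq_abs]
  rcases le_total |y| 1 with h | h
  · have := pow_le_one₀ (n := 2) (abs_nonneg y) h
    have := pow_nonneg (abs_nonneg y) 3
    linarith
  · have := pow_le_pow_right₀ h (show 2 ≤ 3 by norm_num)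
    linarith

theorem abs_le_one_add_abs_cube (y : ℝ) : |y| ≤ 1 + |y| ^ 3 := by
  rcases le_total |y| 1 with h | h
  · have := pow_nonneg (abs_nonneg y) 3
    linarith
  · have := le_self_pow₀ h (show 3 ≠ 0 by norm_num)
    linarith

/-- Second order expansion of a centered characteristic function with a cubic error controlled
by the third absolute moment. -/
theorem norm_centeredCharFun_sub_exp_le {ν : Measure ℝ} [IsProbabilityMeasure ν] {b B : ℝ}
    (h3 : Integrable (fun x => |x - b| ^ 3) ν) (hB : ∫ x, |x - b| ^ 3 ∂ν ≤ B)
    (hmean : ∫ x, x ∂ν = b) {u : ℝ} (hu : |u| ≤ 1) :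
    ‖centeredCharFun ν b u - (Real.exp (-((∫ x, (x - b) ^ 2 ∂ν) / 2) * u ^ 2) : ℝ)‖ ≤
      (4 * B + (1 + B) ^ 2) * |u| ^ 3 := by
  have h1 : Integrable (fun x => x - b) ν := by
    refine ((integrable_const 1).add h3).mono' (by fun_prop) (ae_of_all _ fun x => ?_)
    exact abs_le_one_add_abs_cube _
  have h2 : Integrable (fun x => (x - b) ^ 2) ν := by
    refine ((integrable_const 1).add h3).mono' (by fun_prop) (ae_of_all _ fun x => ?_)
    rw [Real.norm_of_nonneg (sq_nonneg _)]
    exact sq_le_one_add_abs_cube _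
  set v := ∫ x, (x - b) ^ 2 ∂ν with hv
  have hv0 : 0 ≤ v := integral_nonneg fun x => sq_nonneg _
  have hvB : v ≤ 1 + B := by
    calc v ≤ ∫ x, (1 + |x - b| ^ 3) ∂ν :=
          integral_mono h2 ((integrable_const 1).add h3) fun x => sq_le_one_add_abs_cube _
      _ = 1 + ∫ x, |x - b| ^ 3 ∂ν := by rw [integral_add (integrable_const 1) h3]; simp
      _ ≤ _ := by linarith
  have hx : Integrable (fun x : ℝ => x) ν :=
    (h1.add (integrable_const b)).congr (ae_of_all _ fun x => by simp)
  have hz : ∫ x, (x - b) ∂ν = 0 := by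
    rw [integral_sub hx (integrable_const b), hmean]; simp
  have hT : ∫ x, ((1 : ℂ) + ((u * (x - b) : ℝ) : ℂ) * Complex.I -
      ((u * (x - b) : ℝ) : ℂ) ^ 2 / 2) ∂ν =
      ((1 - v / 2 * u ^ 2 : ℝ) : ℂ) := by
    have e : ∀ x : ℝ, (1 : ℂ) + ((u * (x - b) : ℝ) : ℂ) * Complex.I -
        ((u * (x - b) : ℝ) : ℂ) ^ 2 / 2 = ((1 - u ^ 2 / 2 * (x - b) ^ 2 : ℝ) : ℂ) +
          ((x - b : ℝ) : ℂ) * (u * Complex.I) := by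
      intro x; push_cast; ring
    simp_rw [e]
    have i1 : Integrable (fun x : ℝ => ((1 - u ^ 2 / 2 * (x - b) ^ 2 : ℝ) : ℂ)) ν :=
      (((integrable_const (1 : ℝ)).sub (h2.const_mul (u ^ 2 / 2)))).ofReal
    have i2 : Integrable (fun x : ℝ => ((x - b : ℝ) : ℂ) * (u * Complex.I)) ν :=
      h1.ofReal.mul_const _
    rw [integral_add i1 i2, integral_mul_const, integral_complex_ofReal, integral_complex_ofReal,
      hz, integral_sub (integrable_const _) (h2.const_mul _), integral_const_mul]
    simp only [integral_const, probReal_univ, smul_eq_mul, Complex.ofReal_zero, zero_mul, add_zero]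
    congr 1
    ring
  have hTi : Integrable (fun x : ℝ => ((1 : ℂ) + ((u * (x - b) : ℝ) : ℂ) * Complex.I -
      ((u * (x - b) : ℝ) : ℂ) ^ 2 / 2)) ν := by
    have i1 : Integrable (fun x : ℝ => ((u * (x - b) : ℝ) : ℂ)) ν := (h1.const_mul u).ofReal
    have i2 : Integrable (fun x : ℝ => (((u ^ 2 / 2) * (x - b) ^ 2 : ℝ) : ℂ)) ν :=
      (h2.const_mul _).ofReal
    refine (((integrable_const (1 : ℂ)).add (i1.mul_const Complex.I)).sub i2).congr
      (ae_of_all _ fun x => ?_)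
    simp only [Pi.sub_apply, Pi.add_apply]
    push_cast; ring
  have ha : ‖centeredCharFun ν b u - ((1 - v / 2 * u ^ 2 : ℝ) : ℂ)‖ ≤ 4 * B * |u| ^ 3 := by
    rw [centeredCharFun_eq_integral, ← hT, ← integral_sub (integrable_exp_mul_sub_mul_I ν b u) hTi]
    calc _ ≤ ∫ x, 4 * |u| ^ 3 * |x - b| ^ 3 ∂ν := by
          refine norm_integral_le_of_norm_le (h3.const_mul _) (ae_of_all _ fun x => ?_)
          refine (norm_exp_mul_I_sub_taylor_le _).trans_eq ?_
          rw [abs_mul]; ring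
      _ = 4 * |u| ^ 3 * ∫ x, |x - b| ^ 3 ∂ν := by rw [integral_const_mul]
      _ ≤ 4 * |u| ^ 3 * B := by gcongr
      _ = _ := by ring
  have hb : |Real.exp (-(v / 2) * u ^ 2) - (1 - v / 2 * u ^ 2)| ≤ (1 + B) ^ 2 * |u| ^ 3 := by
    have := abs_exp_neg_sub_one_add_le (x := v / 2 * u ^ 2) (by positivity)
    rw [← neg_mul] at this
    refine this.trans ?_
    have hu4 : |u| ^ 4 ≤ |u| ^ 3 := pow_le_pow_of_le_one (abs_nonneg u) hu (by norm_num)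
    calc (v / 2 * u ^ 2) ^ 2 = (v / 2) ^ 2 * |u| ^ 4 := by rw [← sq_abs u]; ring
      _ ≤ (1 + B) ^ 2 * |u| ^ 3 := by
        gcongr
        linarith
  calc _ ≤ ‖centeredCharFun ν b u - ((1 - v / 2 * u ^ 2 : ℝ) : ℂ)‖ +
        ‖((1 - v / 2 * u ^ 2 : ℝ) : ℂ) - (Real.exp (-(v / 2) * u ^ 2) : ℝ)‖ :=
        norm_sub_le_norm_sub_add_norm_sub _ _ _
    _ ≤ 4 * B * |u| ^ 3 + (1 + B) ^ 2 * |u| ^ 3 := by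
        gcongr
        rw [← Complex.ofReal_sub, Complex.norm_real, Real.norm_eq_abs, abs_sub_comm]
        exact hb
    _ = _ := by ring

/-- A law whose characteristic function has a small `L^{2m}` norm cannot be too concentrated. -/
theorem le_integral_sub_sq_of_integral_normSq_charFun_pow_le {ν : Measure ℝ}
    [IsProbabilityMeasure ν] {b C : ℝ} {m : ℕ} (hm : 1 ≤ m) (hC0 : 0 ≤ C)
    (h2 : Integrable (fun x => (x - b) ^ 2) ν)
    (hi : Integrable (fun u => (‖charFun ν u‖ ^ 2) ^ m))
    (hC : ∫ u, (‖charFun ν u‖ ^ 2) ^ m ≤ C) :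
    1 / (2 * m * (C + 1) ^ 2) ≤ ∫ x, (x - b) ^ 2 ∂ν := by
  by_contra! hlt
  set v := ∫ x, (x - b) ^ 2 ∂ν with hv
  have hv0 : 0 ≤ v := integral_nonneg fun x => sq_nonneg _
  have hm0 : (0 : ℝ) < m := by exact_mod_cast hm
  rw [lt_div_iff₀ (by positivity)] at hlt
  -- an interval of length `2 (C + 1)` contributes at least `C + 1` to the integral
  have hlow : ∀ u ∈ Set.Icc (-(C + 1)) (C + 1), (1 / 2 : ℝ) ≤ (‖charFun ν u‖ ^ 2) ^ m := by
    intro u hu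
    have h := one_sub_normSq_charFun_le_sq_mul h2 u
    rw [← hv] at h
    have hu2 : u ^ 2 ≤ (C + 1) ^ 2 := sq_le_sq' hu.1 hu.2
    have hb := one_add_mul_sub_le_pow (a := ‖charFun ν u‖ ^ 2)
      (by linarith [sq_nonneg ‖charFun ν u‖]) m
    have h1 : m * (1 - ‖charFun ν u‖ ^ 2) ≤ m * ((C + 1) ^ 2 * v) := by
      gcongr
      exact h.trans (by gcongr)
    linarith
  have : (C + 1 : ℝ) ≤ C := by
    calc (C + 1 : ℝ) = ∫ u in Set.Icc (-(C + 1)) (C + 1), (1 / 2 : ℝ) := by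
          rw [setIntegral_const, Real.volume_real_Icc_of_le (by linarith), smul_eq_mul]; ring
      _ ≤ ∫ u in Set.Icc (-(C + 1)) (C + 1), (‖charFun ν u‖ ^ 2) ^ m := by
          refine setIntegral_mono_on (by simp) hi.integrableOn measurableSet_Icc hlow
      _ ≤ ∫ u, (‖charFun ν u‖ ^ 2) ^ m :=
          setIntegral_le_integral hi (ae_of_all _ fun w => by positivity)
      _ ≤ C := hC
  linarith

/-- Uniform local limit theorem, in Fourier form: the error depends only on a bound `B` for the
third absolute central moment and on a bound `C` for an integral of a power of the
characteristic function. -/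
theorem exists_integral_norm_centeredCharFun_pow_sub_le {B C : ℝ} (hB0 : 0 ≤ B) (hC0 : 0 ≤ C)
    {m : ℕ} (hm : 1 ≤ m) :
    ∃ v₀ : ℝ, 0 < v₀ ∧ ∃ E : ℕ → ℝ, Tendsto E atTop (𝓝 0) ∧
      ∀ (ν : Measure ℝ) [IsProbabilityMeasure ν] (b : ℝ),
      Integrable (fun x => |x - b| ^ 3) ν → ∫ x, |x - b| ^ 3 ∂ν ≤ B → ∫ x, x ∂ν = b →
      Integrable (fun u => (‖charFun ν u‖ ^ 2) ^ m) → ∫ u, (‖charFun ν u‖ ^ 2) ^ m ≤ C →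
      v₀ ≤ ∫ x, (x - b) ^ 2 ∂ν ∧ ∀ n : ℕ, 2 * m ≤ n →
        Integrable (fun u => centeredCharFun ν b u ^ n) ∧
        √n * ∫ u, ‖centeredCharFun ν b u ^ n -
          ((Real.exp (-((∫ x, (x - b) ^ 2 ∂ν) / 2) * u ^ 2) : ℝ) : ℂ) ^ n‖ ≤ E n := by
  have hm0 : (0 : ℝ) < m := by exact_mod_cast hm
  have hv₀ : (0 : ℝ) < 1 / (2 * m * (C + 1) ^ 2) := by positivity
  refine ⟨1 / (2 * m * (C + 1) ^ 2), hv₀, ?_⟩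
  obtain ⟨a, ha, hE⟩ := exists_integral_norm_pow_sub_pow_le (C := C) hv₀
    (show 0 < 1 + B by positivity) (show 0 < 4 * B + (1 + B) ^ 2 by positivity) (2 * m)
  obtain ⟨η, hη, hη1, hgap⟩ := exists_normSq_charFun_le_one_sub (C := C) ha
    (show 0 < 2 + B by positivity) m
  obtain ⟨E, hEt, hE⟩ := hE η hη hη1
  refine ⟨E, hEt, ?_⟩
  intro ν _ b h3 hB hmean hi hC
  have h2 : Integrable (fun x => (x - b) ^ 2) ν := by
    refine ((integrable_const 1).add h3).mono' (by fun_prop) (ae_of_all _ fun x => ?_)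
    rw [Real.norm_of_nonneg (sq_nonneg _)]
    exact sq_le_one_add_abs_cube _
  have hvB : ∫ x, (x - b) ^ 2 ∂ν ≤ 1 + B := by
    calc _ ≤ ∫ x, (1 + |x - b| ^ 3) ∂ν :=
          integral_mono h2 ((integrable_const 1).add h3) fun x => sq_le_one_add_abs_cube _
      _ = 1 + ∫ x, |x - b| ^ 3 ∂ν := by rw [integral_add (integrable_const 1) h3]; simp
      _ ≤ _ := by linarith
  have hv0 := le_integral_sub_sq_of_integral_normSq_charFun_pow_le hm hC0 h2 hi hC
  refine ⟨hv0, fun n hn => ?_⟩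
  have hLip : ∀ u, 1 - ‖charFun ν u‖ ^ 2 ≤ (2 + B) * |u| := by
    intro u
    rcases le_total |u| 1 with hu | hu
    · have h := one_sub_normSq_charFun_le_sq_mul h2 u
      have hu2 : u ^ 2 ≤ |u| := by rw [← sq_abs]; nlinarith [abs_nonneg u]
      calc _ ≤ _ := h
        _ ≤ |u| * (2 + B) := by gcongr; linarith
        _ = _ := by ring
    · nlinarith [sq_nonneg ‖charFun ν u‖]
  refine hE (centeredCharFun ν b) _ (measurable_centeredCharFun ν b) hv0 hvB ?_ ?_ ?_ ?_ ?_ n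
    (by omega) hn
  · exact fun u hu => norm_centeredCharFun_sub_exp_le h3 hB hmean hu
  · intro u; rw [norm_centeredCharFun]; exact norm_charFun_le_one u
  · intro u hu; rw [norm_centeredCharFun]; exact hgap ν hLip hi hC u hu
  · simpa only [norm_centeredCharFun, pow_mul] using hi
  · simpa only [norm_centeredCharFun, pow_mul] using hC

/-! ### Convolution powers, tilting and densities -/

/-- The `n`-fold convolution power of a measure on `ℝ`. -/
noncomputable def convPow (μ : Measure ℝ) : ℕ → Measure ℝ
  | 0 => Measure.dirac 0
  | n + 1 => μ ∗ convPow μ n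

instance isProbabilityMeasure_convPow (μ : Measure ℝ) [IsProbabilityMeasure μ] (n : ℕ) :
    IsProbabilityMeasure (convPow μ n) := by
  induction n with
  | zero => unfold convPow; infer_instance
  | succ n ih => unfold convPow; infer_instance

theorem map_sum_range_eq_convPow {Ω' : Type*} [MeasurableSpace Ω'] {P' : Measure Ω'}
    [IsProbabilityMeasure P'] {ξ : ℕ → Ω' → ℝ} (hindep : iIndepFun ξ P')
    (hm : ∀ k, AEMeasurable (ξ k) P') {μ : Measure ℝ} (hμ : ∀ k, P'.map (ξ k) = μ) (n : ℕ) :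
    P'.map (fun ω => ∑ k ∈ Finset.range n, ξ k ω) = convPow μ n := by
  induction n with
  | zero => simp [convPow, Measure.map_const]
  | succ n ih =>
    have hi : IndepFun (ξ n) (∑ k ∈ Finset.range n, ξ k) P' :=
      (hindep.indepFun_finsetSum_of_notMem₀ hm (by simp)).symm
    have hS : (∑ k ∈ Finset.range n, ξ k) = fun ω => ∑ k ∈ Finset.range n, ξ k ω := by
      ext ω; simp
    have h := hi.map_add_eq_map_conv_map₀ (hm n) (Finset.aemeasurable_sum _ fun k _ => hm k)
    rw [hμ, hS, ih] at h
    rw [convPow, ← h]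
    congr 1
    ext ω
    simp [Finset.sum_range_succ, add_comm]

theorem integral_cexp_mul_convPow (μ : Measure ℝ) [IsProbabilityMeasure μ] (z : ℂ) (n : ℕ) :
    ∫ x, Complex.exp (z * x) ∂(convPow μ n) = (∫ x, Complex.exp (z * x) ∂μ) ^ n := by
  induction n with
  | zero => simp [convPow]
  | succ n ih =>
    rw [convPow, Measure.conv, integral_map (by fun_prop) (by fun_prop), pow_succ', ← ih,
      ← integral_prod_mul]
    congr 1; ext p
    rw [← Complex.exp_add]; congr 1; push_cast; ring

theorem integrable_exp_mul_convPow {μ : Measure ℝ} [IsProbabilityMeasure μ] {t : ℝ}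
    (h : Integrable (fun x => Real.exp (t * x)) μ) (n : ℕ) :
    Integrable (fun x => Real.exp (t * x)) (convPow μ n) := by
  induction n with
  | zero => exact integrable_dirac (by simp)
  | succ n ih =>
    rw [convPow, Measure.conv, integrable_map_measure (by fun_prop) (by fun_prop)]
    refine (h.mul_prod ih).congr (ae_of_all _ fun p => ?_)
    simp only [Function.comp, ← Real.exp_add]
    congr 1; ring

theorem mgf_convPow (μ : Measure ℝ) [IsProbabilityMeasure μ] (t : ℝ) (n : ℕ) :
    mgf id (convPow μ n) t = mgf id μ t ^ n := by
  have h := integral_cexp_mul_convPow μ t n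
  simp only [← Complex.ofReal_mul, ← Complex.ofReal_exp, integral_complex_ofReal] at h
  exact_mod_cast h

theorem convPow_absolutelyContinuous {μ : Measure ℝ} [IsProbabilityMeasure μ] {m n : ℕ}
    (h : convPow μ m ≪ volume) (hmn : m ≤ n) : convPow μ n ≪ volume := by
  induction n, hmn using Nat.le_induction with
  | base => exact h
  | succ n _ ih => exact Measure.conv_absolutelyContinuous ih

theorem charFun_tilted_eq (ρ : Measure ℝ) (t u : ℝ) :
    charFun (ρ.tilted (fun x => t * x)) u =
      (∫ x, Complex.exp ((t + u * Complex.I) * x) ∂ρ) / (mgf id ρ t : ℂ) := by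
  rw [charFun_apply_real, integral_tilted, ← integral_div]
  congr 1; ext x
  have : ∫ x, Real.exp (t * x) ∂ρ = mgf id ρ t := rfl
  rw [this, Complex.real_smul, Complex.ofReal_div, div_mul_eq_mul_div, Complex.ofReal_exp,
    ← Complex.exp_add]
  congr 2; push_cast; ring

/-- Exponential tilting commutes with convolution powers, on the level of characteristic
functions. -/
theorem charFun_tilted_convPow (μ : Measure ℝ) [IsProbabilityMeasure μ] (t u : ℝ) (n : ℕ) :
    charFun ((convPow μ n).tilted (fun x => t * x)) u =
      charFun (μ.tilted (fun x => t * x)) u ^ n := by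
  rw [charFun_tilted_eq, charFun_tilted_eq, integral_cexp_mul_convPow, mgf_convPow, div_pow]
  push_cast; rfl

/-- The continuous density of a law with integrable characteristic function, given by the
inversion formula. -/
noncomputable def fourierDensity (ρ : Measure ℝ) (x : ℝ) : ℝ :=
  ((2 * Real.pi : ℝ)⁻¹ * ∫ u : ℝ, Complex.exp (-(u * x * Complex.I)) * charFun ρ u).re

theorem rnDeriv_ae_eq_fourierDensity {ρ : Measure ℝ} [IsFiniteMeasure ρ] (hac : ρ ≪ volume)
    (h : Integrable (charFun ρ)) :
    ∀ᵐ x : ℝ, (ρ.rnDeriv volume x).toReal = fourierDensity ρ x := by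
  filter_upwards [rnDeriv_ae_eq_integral_charFun hac h] with x hx
  have := congrArg Complex.re hx
  rw [Complex.ofReal_re] at this
  rw [this, fourierDensity]

theorem continuous_fourierDensity {ρ : Measure ℝ} (h : Integrable (charFun ρ)) :
    Continuous (fourierDensity ρ) := by
  unfold fourierDensity
  refine Complex.continuous_re.comp (continuous_const.mul ?_)
  refine continuous_of_dominated (bound := fun u => ‖charFun ρ u‖) ?_ ?_ h.norm ?_
  · intro x
    exact (Continuous.aestronglyMeasurable (by fun_prop)).mul h.aestronglyMeasurable
  · intro x
    refine ae_of_all _ fun u => ?_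
    rw [norm_mul, ← Complex.ofReal_mul, ← neg_mul, ← Complex.ofReal_neg,
      Complex.norm_exp_ofReal_mul_I, one_mul]
  · exact ae_of_all _ fun u => by fun_prop

theorem fourierDensity_tilted {ρ : Measure ℝ} [IsProbabilityMeasure ρ] (hac : ρ ≪ volume) {t : ℝ}
    (h0 : Integrable (charFun ρ)) (ht : Integrable (charFun (ρ.tilted (fun x => t * x)))) (x : ℝ) :
    fourierDensity (ρ.tilted (fun x => t * x)) x =
      Real.exp (t * x) / mgf id ρ t * fourierDensity ρ x := by
  have hac' : ρ.tilted (fun x => t * x) ≪ volume := (tilted_absolutelyContinuous _ _).trans hac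
  have hae : fourierDensity (ρ.tilted (fun x => t * x)) =ᵐ[volume]
      fun x => Real.exp (t * x) / mgf id ρ t * fourierDensity ρ x := by
    filter_upwards [rnDeriv_ae_eq_fourierDensity hac h0, rnDeriv_ae_eq_fourierDensity hac' ht,
      toReal_rnDeriv_tilted_left (μ := ρ) (ν := volume) (f := fun x => t * x) (by fun_prop)]
      with y h1 h2 h3
    rw [← h1, ← h2, h3]; rfl
  have hc := continuous_fourierDensity h0
  have := (Continuous.ae_eq_iff_eq volume (continuous_fourierDensity ht)
    (by fun_prop)).1 hae
  exact congrFun this x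

/-- If a law is dominated by a multiple of a centered Gaussian, then its exponential tilts have
bounded densities. -/
theorem tilted_le_smul_volume {ρ : Measure ℝ} {C : ℝ} {m : ℕ} (hm : 1 ≤ m) (hC : 0 ≤ C)
    (h : ρ ≤ ENNReal.ofReal C • gaussianReal 0 m) (t : ℝ) :
    ρ.tilted (fun x => t * x) ≤
      ENNReal.ofReal (C * (Real.exp (m * t ^ 2 / 2) / mgf id ρ t)) • volume := by
  have hm0 : (1 : ℝ) ≤ m := by exact_mod_cast hm
  have hmz : (m : ℝ≥0) ≠ 0 := by exact_mod_cast (by omega : m ≠ 0)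
  have hmgf : 0 ≤ mgf id ρ t := mgf_nonneg
  refine Measure.le_iff.2 fun s hs => ?_
  rw [tilted_apply' _ _ hs]
  have hpt : ∀ x : ℝ, gaussianPDFReal 0 m x * (Real.exp (t * x) / mgf id ρ t) ≤
      Real.exp (m * t ^ 2 / 2) / mgf id ρ t := by
    intro x
    rw [← mul_div_assoc]
    gcongr
    have h1 : (√(2 * Real.pi * (m : ℝ≥0)))⁻¹ ≤ 1 := by
      refine inv_le_one_of_one_le₀ (Real.one_le_sqrt.2 ?_)
      push_cast
      nlinarith [Real.pi_gt_three]
    have h2 : Real.exp (-(x - 0) ^ 2 / (2 * ((m : ℝ≥0) : ℝ))) * Real.exp (t * x) ≤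
        Real.exp (m * t ^ 2 / 2) := by
      rw [← Real.exp_add]
      apply Real.exp_le_exp.2
      push_cast
      have : m * t ^ 2 / 2 - (-(x - 0) ^ 2 / (2 * (m : ℝ)) + t * x) =
          (x - m * t) ^ 2 / (2 * m) := by field_simp; ring
      have : 0 ≤ (x - m * t) ^ 2 / (2 * (m : ℝ)) := by positivity
      linarith
    calc _ = (√(2 * Real.pi * (m : ℝ≥0)))⁻¹ *
          (Real.exp (-(x - 0) ^ 2 / (2 * ((m : ℝ≥0) : ℝ))) * Real.exp (t * x)) := by
          rw [gaussianPDFReal]; ring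
      _ ≤ 1 * Real.exp (m * t ^ 2 / 2) := by gcongr
      _ = _ := one_mul _
  have e : ∫ x, Real.exp (t * x) ∂ρ = mgf id ρ t := rfl
  rw [e]
  calc ∫⁻ x in s, ENNReal.ofReal (Real.exp (t * x) / mgf id ρ t) ∂ρ
      ≤ ∫⁻ x in s, ENNReal.ofReal (Real.exp (t * x) / mgf id ρ t)
          ∂(ENNReal.ofReal C • gaussianReal 0 m) :=
        lintegral_mono' (Measure.restrict_mono le_rfl h) le_rfl
    _ = ENNReal.ofReal C * ∫⁻ x in s, gaussianPDF 0 m x *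
          ENNReal.ofReal (Real.exp (t * x) / mgf id ρ t) := by
        rw [Measure.restrict_smul, lintegral_smul_measure, gaussianReal_of_var_ne_zero _ hmz,
          restrict_withDensity hs, lintegral_withDensity_eq_lintegral_mul _ (by fun_prop)
            (by fun_prop)]
        rfl
    _ ≤ ENNReal.ofReal C * ∫⁻ x in s, ENNReal.ofReal (Real.exp (m * t ^ 2 / 2) / mgf id ρ t) := by
        gcongr with x
        rw [gaussianPDF, ← ENNReal.ofReal_mul (gaussianPDFReal_nonneg _ _ _)]
        exact ENNReal.ofReal_le_ofReal (hpt x)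
    _ = _ := by
        rw [setLIntegral_const, ← mul_assoc, ← ENNReal.ofReal_mul hC]
        rfl

/-! ### The gap function and the density ratio -/

section Gap

variable {μ : Measure ℝ}

theorem mem_interior_integrableExpSet_id (hI : ∀ t : ℝ, Integrable (fun x => Real.exp (t * x)) μ)
    (t : ℝ) : t ∈ interior (integrableExpSet id μ) := by
  have : integrableExpSet id μ = Set.univ := Set.eq_univ_of_forall hI
  rw [this]; simp

theorem mgf_id_eq_exp_sub_gap [IsProbabilityMeasure μ]
    (hI : ∀ t : ℝ, Integrable (fun x => Real.exp (t * x)) μ) (t : ℝ) :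
    mgf id μ t = Real.exp (t ^ 2 / 2 - logLaplaceGap id μ t) := by
  rw [logLaplaceGap, sub_sub_cancel, exp_cgf (X := id) (hI t)]

theorem contDiff_cgf_id (hI : ∀ t : ℝ, Integrable (fun x => Real.exp (t * x)) μ) :
    ContDiff ℝ 2 (cgf id μ) :=
  contDiff_iff_contDiffAt.2 fun t =>
    (analyticAt_cgf (mem_interior_integrableExpSet_id hI t)).contDiffAt

theorem contDiff_logLaplaceGap_id (hI : ∀ t : ℝ, Integrable (fun x => Real.exp (t * x)) μ) :
    ContDiff ℝ 2 (logLaplaceGap id μ) := by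
  have := contDiff_cgf_id hI
  unfold logLaplaceGap
  fun_prop

theorem deriv_logLaplaceGap_id (hI : ∀ t : ℝ, Integrable (fun x => Real.exp (t * x)) μ) (t : ℝ) :
    deriv (logLaplaceGap id μ) t = t - deriv (cgf id μ) t := by
  have h1 : HasDerivAt (fun t : ℝ => t ^ 2 / 2) t t := by
    simpa using (hasDerivAt_pow 2 t).div_const 2
  have h2 := ((contDiff_cgf_id hI).differentiable (by norm_num) t).hasDerivAt
  exact (h1.sub h2).deriv

theorem iteratedDeriv_two_logLaplaceGap_id
    (hI : ∀ t : ℝ, Integrable (fun x => Real.exp (t * x)) μ) (t : ℝ) :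
    iteratedDeriv 2 (logLaplaceGap id μ) t = 1 - iteratedDeriv 2 (cgf id μ) t := by
  simp only [iteratedDeriv_succ, iteratedDeriv_zero]
  rw [show deriv (logLaplaceGap id μ) = fun t => t - deriv (cgf id μ) t from
      funext (deriv_logLaplaceGap_id hI)]
  have h2 : DifferentiableAt ℝ (deriv (cgf id μ)) t :=
    ((contDiff_cgf_id hI).differentiable_deriv_two) t
  exact ((hasDerivAt_id t).sub h2.hasDerivAt).deriv

theorem isProbabilityMeasure_tilted_mul [IsProbabilityMeasure μ]
    (hI : ∀ t : ℝ, Integrable (fun x => Real.exp (t * x)) μ) (t : ℝ) :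
    IsProbabilityMeasure (μ.tilted (fun x => t * x)) :=
  isProbabilityMeasure_tilted (hI t)

theorem integral_id_tilted_mul [IsProbabilityMeasure μ]
    (hI : ∀ t : ℝ, Integrable (fun x => Real.exp (t * x)) μ) (t : ℝ) :
    ∫ x, x ∂(μ.tilted (fun x => t * x)) = t - deriv (logLaplaceGap id μ) t := by
  rw [deriv_logLaplaceGap_id hI, sub_sub_cancel]
  exact integral_tilted_mul_self (X := id) (mem_interior_integrableExpSet_id hI t)

theorem integral_sub_sq_tilted_mul [IsProbabilityMeasure μ]
    (hI : ∀ t : ℝ, Integrable (fun x => Real.exp (t * x)) μ)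
    (t : ℝ) :
    ∫ x, (x - (t - deriv (logLaplaceGap id μ) t)) ^ 2 ∂(μ.tilted (fun x => t * x)) =
      1 - iteratedDeriv 2 (logLaplaceGap id μ) t := by
  rw [iteratedDeriv_two_logLaplaceGap_id hI, sub_sub_cancel, ← integral_id_tilted_mul hI]
  have h := variance_tilted_mul (X := id) (mem_interior_integrableExpSet_id hI t)
  rw [variance_eq_integral (by fun_prop)] at h
  exact h

theorem integrable_exp_mul_sub_tilted (hI : ∀ t : ℝ, Integrable (fun x => Real.exp (t * x)) μ)
    (t s b : ℝ) :
    Integrable (fun x => Real.exp (s * (x - b))) (μ.tilted (fun x => t * x)) := by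
  rw [integrable_tilted_iff (hI t)]
  refine ((hI (t + s)).mul_const (Real.exp (-(s * b)))).congr (ae_of_all _ fun x => ?_)
  simp only [smul_eq_mul, ← Real.exp_add]
  congr 1; ring

/-- Exponential moments of the tilted law around its mean, in terms of the gap function. -/
theorem integral_exp_mul_sub_tilted [IsProbabilityMeasure μ]
    (hI : ∀ t : ℝ, Integrable (fun x => Real.exp (t * x)) μ)
    (t s : ℝ) :
    ∫ x, Real.exp (s * (x - (t - deriv (logLaplaceGap id μ) t))) ∂(μ.tilted (fun x => t * x)) =
      Real.exp (s ^ 2 / 2 + s * deriv (logLaplaceGap id μ) t + logLaplaceGap id μ t -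
        logLaplaceGap id μ (t + s)) := by
  set d := deriv (logLaplaceGap id μ) t
  rw [integral_tilted]
  have e : ∫ x, Real.exp (t * x) ∂μ = mgf id μ t := rfl
  have e2 : ∀ x : ℝ, (Real.exp (t * x) / mgf id μ t) • Real.exp (s * (x - (t - d))) =
      Real.exp ((t + s) * x) * (Real.exp (-(s * (t - d))) / mgf id μ t) := by
    intro x
    rw [smul_eq_mul, div_mul_eq_mul_div, ← mul_div_assoc, ← Real.exp_add, ← Real.exp_add]
    congr 2; ring
  simp_rw [e, e2]
  rw [integral_mul_const]
  have e3 : ∫ x, Real.exp ((t + s) * x) ∂μ = mgf id μ (t + s) := rfl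
  rw [e3, mgf_id_eq_exp_sub_gap hI, mgf_id_eq_exp_sub_gap hI, ← Real.exp_sub, ← Real.exp_add]
  congr 1; ring

/-- Jensen's inequality for the tilted law; equivalently, `A'' ≤ 1` integrated twice. -/
theorem logLaplaceGap_add_le [IsProbabilityMeasure μ]
    (hI : ∀ t : ℝ, Integrable (fun x => Real.exp (t * x)) μ) (t s : ℝ) :
    logLaplaceGap id μ (t + s) ≤
      logLaplaceGap id μ t + s * deriv (logLaplaceGap id μ) t + s ^ 2 / 2 := by
  have := isProbabilityMeasure_tilted_mul hI t
  have hmean := integral_id_tilted_mul hI t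
  set b := t - deriv (logLaplaceGap id μ) t with hb
  have hx : Integrable (fun x : ℝ => x) (μ.tilted (fun x => t * x)) := by
    have := memLp_tilted_mul (X := id) (mem_interior_integrableExpSet_id hI t) 1
    exact memLp_one_iff_integrable.1 (by exact_mod_cast this)
  have hl : Integrable (fun x : ℝ => s * (x - b)) (μ.tilted (fun x => t * x)) :=
    (hx.sub (integrable_const b)).const_mul s
  have h1 : (1 : ℝ) ≤ ∫ x, Real.exp (s * (x - b)) ∂(μ.tilted (fun x => t * x)) := by
    calc (1 : ℝ) = ∫ x, (s * (x - b) + 1) ∂(μ.tilted (fun x => t * x)) := by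
          rw [integral_add hl (integrable_const 1),
            integral_const_mul, integral_sub hx (integrable_const b), hmean]
          simp
      _ ≤ _ := integral_mono (hl.add (integrable_const 1))
          (integrable_exp_mul_sub_tilted hI t s b) fun x => Real.add_one_le_exp _
  rw [integral_exp_mul_sub_tilted hI, Real.one_le_exp_iff] at h1
  linarith

/-- The quadratic upper bound for `A` is minimal at `t - A' t`, where `A` is still nonnegative. -/
theorem deriv_logLaplaceGap_sq_le [IsProbabilityMeasure μ]
    (hI : ∀ t : ℝ, Integrable (fun x => Real.exp (t * x)) μ)
    (hA : ∀ t, 0 ≤ logLaplaceGap id μ t) (t : ℝ) :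
    deriv (logLaplaceGap id μ) t ^ 2 ≤ 2 * logLaplaceGap id μ t := by
  have h := logLaplaceGap_add_le hI t (-deriv (logLaplaceGap id μ) t)
  have := hA (t + -deriv (logLaplaceGap id μ) t)
  linarith

theorem abs_cube_le_exp_add_exp (y : ℝ) :
    |y| ^ 3 ≤ 6 * (Real.exp (1 * y) + Real.exp (-1 * y)) := by
  have h := Real.pow_div_factorial_le_exp (x := |y|) (abs_nonneg y) 3
  have h2 : Real.exp |y| ≤ Real.exp (1 * y) + Real.exp (-1 * y) := by
    rcases abs_cases y with ⟨h, _⟩ | ⟨h, _⟩ <;> rw [h] <;> simp <;> positivity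
  have : ((3 : ℕ).factorial : ℝ) = 6 := by norm_num [Nat.factorial]
  rw [this] at h
  linarith

theorem integrable_abs_cube_tilted (hI : ∀ t : ℝ, Integrable (fun x => Real.exp (t * x)) μ)
    (t b : ℝ) : Integrable (fun x => |x - b| ^ 3) (μ.tilted (fun x => t * x)) := by
  refine (((integrable_exp_mul_sub_tilted hI t 1 b).add
    (integrable_exp_mul_sub_tilted hI t (-1) b)).const_mul 6).mono' (by fun_prop)
    (ae_of_all _ fun x => ?_)
  rw [Real.norm_of_nonneg (by positivity)]
  exact abs_cube_le_exp_add_exp _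

/-- A third moment bound that is uniform in `t` as long as the gap is at most `1`. -/
theorem integral_abs_cube_tilted_le [IsProbabilityMeasure μ]
    (hI : ∀ t : ℝ, Integrable (fun x => Real.exp (t * x)) μ)
    (hA : ∀ t, 0 ≤ logLaplaceGap id μ t) {t : ℝ} (ht : logLaplaceGap id μ t ≤ 1) :
    ∫ x, |x - (t - deriv (logLaplaceGap id μ) t)| ^ 3 ∂(μ.tilted (fun x => t * x)) ≤
      12 * Real.exp 3 := by
  have hd := deriv_logLaplaceGap_sq_le hI hA t
  have hi := fun s => integrable_exp_mul_sub_tilted hI t s (t - deriv (logLaplaceGap id μ) t)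
  have hb : ∀ s : ℝ, s ^ 2 = 1 →
      ∫ x, Real.exp (s * (x - (t - deriv (logLaplaceGap id μ) t)))
        ∂(μ.tilted (fun x => t * x)) ≤ Real.exp 3 := by
    intro s hs
    rw [integral_exp_mul_sub_tilted hI]
    apply Real.exp_le_exp.2
    have := hA (t + s)
    nlinarith [sq_nonneg (s - deriv (logLaplaceGap id μ) t)]
  calc _ ≤ ∫ x, 6 * (Real.exp (1 * (x - (t - deriv (logLaplaceGap id μ) t))) +
          Real.exp (-1 * (x - (t - deriv (logLaplaceGap id μ) t))))
            ∂(μ.tilted (fun x => t * x)) := by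
        refine integral_mono (integrable_abs_cube_tilted hI t _)
          (((hi 1).add (hi (-1))).const_mul 6)
          fun x => abs_cube_le_exp_add_exp _
    _ = 6 * (∫ x, Real.exp (1 * (x - (t - deriv (logLaplaceGap id μ) t)))
            ∂(μ.tilted (fun x => t * x)) +
          ∫ x, Real.exp (-1 * (x - (t - deriv (logLaplaceGap id μ) t)))
            ∂(μ.tilted (fun x => t * x))) := by
        rw [integral_const_mul, integral_add (hi 1) (hi (-1))]
    _ ≤ 6 * (Real.exp 3 + Real.exp 3) := by
        gcongr
        · exact hb 1 (by norm_num)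
        · exact hb (-1) (by norm_num)
    _ = _ := by ring

/-- The ratio of the density of the normalized sum to the standard normal density, at the
point `√n t`. -/
noncomputable def densityRatio (μ : Measure ℝ) (n : ℕ) (t : ℝ) : ℝ :=
  √(2 * Real.pi * n) * Real.exp (n * t ^ 2 / 2) * fourierDensity (convPow μ n) (n * t)

theorem tilted_convPow_le [IsProbabilityMeasure μ]
    (hI : ∀ t : ℝ, Integrable (fun x => Real.exp (t * x)) μ) {C : ℝ} {m : ℕ}
    (hm : 1 ≤ m) (hC : 0 ≤ C)
    (hD : convPow μ m ≤ ENNReal.ofReal C • gaussianReal 0 m) (t : ℝ) :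
    (convPow μ m).tilted (fun x => t * x) ≤
      ENNReal.ofReal (C * Real.exp (m * logLaplaceGap id μ t)) • volume := by
  have h := tilted_le_smul_volume hm hC hD t
  rw [mgf_convPow, mgf_id_eq_exp_sub_gap hI, ← Real.exp_nat_mul, ← Real.exp_sub] at h
  convert h using 5
  ring

/-- Plancherel's inequality for the `m`-fold convolution of the tilted law. -/
theorem integral_normSq_charFun_tilted_pow_le [IsProbabilityMeasure μ]
    (hI : ∀ t : ℝ, Integrable (fun x => Real.exp (t * x)) μ) {C : ℝ} {m : ℕ}
    (hm : 1 ≤ m) (hC : 0 ≤ C)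
    (hD : convPow μ m ≤ ENNReal.ofReal C • gaussianReal 0 m) (t : ℝ) :
    Integrable (fun u => (‖charFun (μ.tilted (fun x => t * x)) u‖ ^ 2) ^ m) ∧
    ∫ u, (‖charFun (μ.tilted (fun x => t * x)) u‖ ^ 2) ^ m ≤
      2 * Real.pi * (C * Real.exp (m * logLaplaceGap id μ t)) := by
  have : IsProbabilityMeasure ((convPow μ m).tilted (fun x => t * x)) :=
    isProbabilityMeasure_tilted (integrable_exp_mul_convPow (hI t) m)
  have hle := tilted_convPow_le hI hm hC hD t
  have h1 := integrable_normSq_charFun (by positivity) hle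
  have h2 := integral_normSq_charFun_le (by positivity) hle
  simp only [charFun_tilted_convPow, norm_pow, ← pow_mul, mul_comm m 2] at h1 h2
  simp only [← pow_mul]
  exact ⟨h1, h2⟩

theorem norm_charFun_pow_le_normSq_pow {ν : Measure ℝ} [IsProbabilityMeasure ν] {m n : ℕ}
    (hn : 2 * m ≤ n) (u : ℝ) : ‖charFun ν u ^ n‖ ≤ (‖charFun ν u‖ ^ 2) ^ m := by
  rw [norm_pow, ← pow_mul]
  exact pow_le_pow_of_le_one (norm_nonneg _) (norm_charFun_le_one u) hn

theorem integrable_charFun_tilted_convPow [IsProbabilityMeasure μ]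
    (hI : ∀ t : ℝ, Integrable (fun x => Real.exp (t * x)) μ) {C : ℝ} {m n : ℕ}
    (hm : 1 ≤ m) (hC : 0 ≤ C)
    (hD : convPow μ m ≤ ENNReal.ofReal C • gaussianReal 0 m) (hn : 2 * m ≤ n) (t : ℝ) :
    Integrable (charFun ((convPow μ n).tilted (fun x => t * x))) := by
  have := isProbabilityMeasure_tilted_mul hI t
  have h := (integral_normSq_charFun_tilted_pow_le hI hm hC hD t).1
  have hmeas : Measurable (charFun (μ.tilted (fun x => t * x))) := measurable_charFun
  rw [show charFun ((convPow μ n).tilted (fun x => t * x)) = fun u =>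
    charFun (μ.tilted (fun x => t * x)) u ^ n from
      funext fun u => charFun_tilted_convPow μ t u n]
  exact h.mono' (by fun_prop) (ae_of_all _ fun u => norm_charFun_pow_le_normSq_pow hn u)

theorem integrable_charFun_convPow [IsProbabilityMeasure μ]
    (hI : ∀ t : ℝ, Integrable (fun x => Real.exp (t * x)) μ) {C : ℝ} {m n : ℕ}
    (hm : 1 ≤ m) (hC : 0 ≤ C)
    (hD : convPow μ m ≤ ENNReal.ofReal C • gaussianReal 0 m) (hn : 2 * m ≤ n) :
    Integrable (charFun (convPow μ n)) := by
  have h := integrable_charFun_tilted_convPow hI hm hC hD hn 0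
  simpa using h

theorem convPow_absolutelyContinuous_of_le_gaussian [IsProbabilityMeasure μ]
    {C : ℝ} {m n : ℕ} (hm : 1 ≤ m)
    (hD : convPow μ m ≤ ENNReal.ofReal C • gaussianReal 0 m) (hn : m ≤ n) :
    convPow μ n ≪ volume := by
  refine convPow_absolutelyContinuous ?_ hn
  refine hD.absolutelyContinuous.trans ?_
  exact (Measure.smul_absolutelyContinuous).trans
    (gaussianReal_absolutelyContinuous 0 (by exact_mod_cast (by omega : m ≠ 0)))

/-- The density ratio at `√n t` as a Fourier integral for the law tilted by `t`. -/
theorem densityRatio_eq [IsProbabilityMeasure μ]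
    (hI : ∀ t : ℝ, Integrable (fun x => Real.exp (t * x)) μ) {C : ℝ} {m n : ℕ}
    (hm : 1 ≤ m) (hC : 0 ≤ C)
    (hD : convPow μ m ≤ ENNReal.ofReal C • gaussianReal 0 m) (hn : 2 * m ≤ n) (t : ℝ) :
    densityRatio μ n t = √(2 * Real.pi * n) * Real.exp (-(n * logLaplaceGap id μ t)) *
      ((2 * Real.pi)⁻¹ * (∫ u, centeredCharFun (μ.tilted (fun x => t * x)) t u ^ n).re) := by
  have h0 := integrable_charFun_convPow hI hm hC hD hn
  have ht := integrable_charFun_tilted_convPow hI hm hC hD hn t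
  have hac := convPow_absolutelyContinuous_of_le_gaussian hm hD (by omega : m ≤ n)
  have h := fourierDensity_tilted hac h0 ht (n * t)
  rw [mgf_convPow, mgf_id_eq_exp_sub_gap hI, ← Real.exp_nat_mul, ← Real.exp_sub] at h
  have h2 : fourierDensity (convPow μ n) (n * t) =
      Real.exp (-(n * t ^ 2 / 2) - n * logLaplaceGap id μ t) *
        fourierDensity ((convPow μ n).tilted (fun x => t * x)) (n * t) := by
    rw [h, ← mul_assoc, ← Real.exp_add]
    ring_nf
    simp
  have h3 : fourierDensity ((convPow μ n).tilted (fun x => t * x)) (n * t) =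
      (2 * Real.pi)⁻¹ * (∫ u, centeredCharFun (μ.tilted (fun x => t * x)) t u ^ n).re := by
    rw [fourierDensity, Complex.re_ofReal_mul]
    congr 3
    ext u
    rw [centeredCharFun, mul_pow, ← Complex.exp_nat_mul, charFun_tilted_convPow]
    congr 2; push_cast; ring
  rw [densityRatio, h2, h3, ← mul_assoc, mul_assoc (√(2 * Real.pi * n)), ← Real.exp_add]
  ring_nf

/-- The density ratio decays exponentially where the gap is not small. -/
theorem densityRatio_le [IsProbabilityMeasure μ]
    (hI : ∀ t : ℝ, Integrable (fun x => Real.exp (t * x)) μ) {C : ℝ} {m n : ℕ}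
    (hm : 1 ≤ m) (hC : 0 ≤ C)
    (hD : convPow μ m ≤ ENNReal.ofReal C • gaussianReal 0 m) (hn : 2 * m ≤ n) (t : ℝ) :
    densityRatio μ n t ≤
      √(2 * Real.pi * n) * (C * Real.exp (-((n - m) * logLaplaceGap id μ t))) := by
  have := isProbabilityMeasure_tilted_mul hI t
  obtain ⟨h1, h2⟩ := integral_normSq_charFun_tilted_pow_le hI hm hC hD t
  rw [densityRatio_eq hI hm hC hD hn, mul_assoc]
  have h3 : (∫ u, centeredCharFun (μ.tilted (fun x => t * x)) t u ^ n).re ≤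
      2 * Real.pi * (C * Real.exp (m * logLaplaceGap id μ t)) := by
    refine (Complex.re_le_norm _).trans (le_trans ?_ h2)
    refine norm_integral_le_of_norm_le h1 (ae_of_all _ fun u => ?_)
    rw [norm_pow, norm_centeredCharFun, ← norm_pow]
    exact norm_charFun_pow_le_normSq_pow hn u
  refine mul_le_mul_of_nonneg_left ?_ (Real.sqrt_nonneg _)
  calc _ ≤ Real.exp (-(n * logLaplaceGap id μ t)) *
        ((2 * Real.pi)⁻¹ * (2 * Real.pi * (C * Real.exp (m * logLaplaceGap id μ t)))) := by
        gcongr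
    _ = C * (Real.exp (-(n * logLaplaceGap id μ t)) * Real.exp (m * logLaplaceGap id μ t)) := by
        field_simp
    _ = _ := by rw [← Real.exp_add]; congr 2; ring

theorem integral_exp_mul_I_mul_exp_neg_mul_sq {q : ℝ} (hq : 0 < q) (c : ℝ) :
    ∫ u : ℝ, Complex.exp (c * u * Complex.I) * ((Real.exp (-q * u ^ 2) : ℝ) : ℂ) =
      ((√(Real.pi / q) * Real.exp (-c ^ 2 / (4 * q)) : ℝ) : ℂ) := by
  have h := fourierIntegral_gaussian (b := (q : ℂ)) (by simpa using hq) c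
  rw [Complex.ofReal_mul, Real.sqrt_eq_rpow, Complex.ofReal_cpow (by positivity)]
  push_cast
  rw [← h]
  congr 1; ext u
  congr 2; ring

/-- Uniform local limit theorem for the density ratios on the set where the gap is at most `1`. -/
theorem exists_densityRatio_sub_le [IsProbabilityMeasure μ]
    (hI : ∀ t : ℝ, Integrable (fun x => Real.exp (t * x)) μ)
    (hA : ∀ t, 0 ≤ logLaplaceGap id μ t) {C : ℝ} {m : ℕ} (hm : 1 ≤ m) (hC : 0 ≤ C)
    (hD : convPow μ m ≤ ENNReal.ofReal C • gaussianReal 0 m) :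
    ∃ v₀ : ℝ, 0 < v₀ ∧ ∃ E : ℕ → ℝ, Tendsto E atTop (𝓝 0) ∧ ∀ t, logLaplaceGap id μ t ≤ 1 →
      v₀ ≤ 1 - iteratedDeriv 2 (logLaplaceGap id μ) t ∧ ∀ n : ℕ, 2 * m ≤ n →
      |densityRatio μ n t - Real.exp (-(n * logLaplaceGap id μ t)) *
        ((√(1 - iteratedDeriv 2 (logLaplaceGap id μ) t))⁻¹ *
          Real.exp (-(n * deriv (logLaplaceGap id μ) t ^ 2 /
            (2 * (1 - iteratedDeriv 2 (logLaplaceGap id μ) t)))))| ≤ E n := by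
  obtain ⟨v₀, hv₀, E, hE, hmain⟩ := exists_integral_norm_centeredCharFun_pow_sub_le
    (B := 12 * Real.exp 3) (C := 2 * Real.pi * (C * Real.exp m)) (by positivity) (by positivity) hm
  refine ⟨v₀, hv₀, E, hE, fun t ht => ?_⟩
  have hprob := isProbabilityMeasure_tilted_mul hI t
  obtain ⟨hi, hle⟩ := integral_normSq_charFun_tilted_pow_le hI hm hC hD t
  set ν := μ.tilted (fun x => t * x) with hν
  set d := deriv (logLaplaceGap id μ) t with hd
  obtain ⟨hv, hmain⟩ := hmain ν (t - d) (integrable_abs_cube_tilted hI t _)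
    (integral_abs_cube_tilted_le hI hA ht) (integral_id_tilted_mul hI t) hi (hle.trans (by
      gcongr
      have : (0 : ℝ) ≤ m := by positivity
      nlinarith))
  rw [integral_sub_sq_tilted_mul hI t] at hv hmain
  set v := 1 - iteratedDeriv 2 (logLaplaceGap id μ) t with hvdef
  refine ⟨hv, fun n hn => ?_⟩
  obtain ⟨hin, hEn⟩ := hmain n hn
  have hv0 : 0 < v := hv₀.trans_le hv
  have hn0 : (0 : ℝ) < n := by exact_mod_cast (by omega : 0 < n)
  have hpi := Real.pi_pos
  set A := logLaplaceGap id μ t with hAt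
  rw [densityRatio_eq hI hm hC hD hn, ← hν, ← hAt]
  -- recentre the tilted law from `t` to its mean `t - A' t`
  have hphase : ∀ u : ℝ, centeredCharFun ν t u ^ n =
      Complex.exp ((-(n * d) : ℝ) * u * Complex.I) * centeredCharFun ν (t - d) u ^ n := by
    intro u
    rw [centeredCharFun, centeredCharFun, mul_pow, mul_pow, ← mul_assoc, ← Complex.exp_nat_mul,
      ← Complex.exp_nat_mul, ← Complex.exp_add]
    congr 2; push_cast; ring
  have hgn : ∀ u : ℝ, ((Real.exp (-(v / 2) * u ^ 2) : ℝ) : ℂ) ^ n =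
      ((Real.exp (-(n * v / 2) * u ^ 2) : ℝ) : ℂ) := by
    intro u
    rw [← Complex.ofReal_pow, ← Real.exp_nat_mul]
    congr 2; ring
  have hG := integral_exp_mul_I_mul_exp_neg_mul_sq (q := n * v / 2) (by positivity) (-(n * d))
  have hgi : Integrable (fun u : ℝ => ((Real.exp (-(n * v / 2) * u ^ 2) : ℝ) : ℂ)) :=
    (integrable_exp_neg_mul_sq (by positivity)).ofReal
  have hnorm : ∀ u : ℝ, ‖Complex.exp ((-(n * d) : ℝ) * u * Complex.I)‖ = 1 := by
    intro u; rw [← Complex.ofReal_mul, Complex.norm_exp_ofReal_mul_I]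
  have hph : ∀ {f : ℝ → ℂ}, Integrable f →
      Integrable (fun u : ℝ => Complex.exp ((-(n * d) : ℝ) * u * Complex.I) * f u) := by
    intro f hf
    refine hf.norm.mono' ?_ (ae_of_all _ fun u => ?_)
    · exact (Continuous.aestronglyMeasurable (by fun_prop)).mul hf.aestronglyMeasurable
    · rw [norm_mul, hnorm, one_mul]
  have hdiff : ‖(∫ u, centeredCharFun ν t u ^ n) -
      ((√(Real.pi / (n * v / 2)) * Real.exp (-(-(n * d)) ^ 2 / (4 * (n * v / 2))) : ℝ) : ℂ)‖ ≤
      ∫ u, ‖centeredCharFun ν (t - d) u ^ n - ((Real.exp (-(v / 2) * u ^ 2) : ℝ) : ℂ) ^ n‖ := by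
    rw [← hG]
    simp_rw [hphase]
    rw [← integral_sub (hph hin) (hph hgi)]
    refine (norm_integral_le_integral_norm _).trans_eq ?_
    congr 1; ext u
    rw [← mul_sub, norm_mul, hnorm, one_mul, hgn]
  have hre : |(∫ u, centeredCharFun ν t u ^ n).re -
      √(Real.pi / (n * v / 2)) * Real.exp (-(-(n * d)) ^ 2 / (4 * (n * v / 2)))| ≤
      ∫ u, ‖centeredCharFun ν (t - d) u ^ n - ((Real.exp (-(v / 2) * u ^ 2) : ℝ) : ℂ) ^ n‖ := by
    refine le_trans ?_ hdiff
    rw [← Complex.ofReal_re (√(Real.pi / (n * v / 2)) *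
      Real.exp (-(-(n * d)) ^ 2 / (4 * (n * v / 2)))), ← Complex.sub_re]
    exact Complex.abs_re_le_norm _
  have hsq : √(2 * Real.pi * n) * ((2 * Real.pi)⁻¹ * √(Real.pi / (n * v / 2))) = (√v)⁻¹ := by
    have : √(2 * Real.pi * n) * √(Real.pi / (n * v / 2)) = 2 * Real.pi * (√v)⁻¹ := by
      rw [← Real.sqrt_mul (by positivity),
        show 2 * Real.pi * n * (Real.pi / (n * v / 2)) = (2 * Real.pi) ^ 2 * v⁻¹ by field_simp,
        Real.sqrt_mul (by positivity), Real.sqrt_sq (by positivity), Real.sqrt_inv]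
    rw [mul_left_comm, this]
    field_simp
  have hex : -(-(n * d)) ^ 2 / (4 * (n * v / 2)) = -(n * d ^ 2 / (2 * v)) := by
    field_simp; ring
  rw [hex] at hre
  have hc : √(2 * Real.pi * n) * (2 * Real.pi)⁻¹ ≤ √(n : ℝ) := by
    rw [Real.sqrt_mul (by positivity), mul_comm (√(2 * Real.pi)), mul_assoc]
    refine mul_le_of_le_one_right (Real.sqrt_nonneg _) ?_
    rw [← div_eq_mul_inv, div_le_one (by positivity), Real.sqrt_le_left (by positivity)]
    nlinarith [Real.pi_gt_three]
  have hexp1 : Real.exp (-(n * A)) ≤ 1 := Real.exp_le_one_iff.2 (by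
    have := mul_nonneg hn0.le (hA t); linarith)
  calc _ = Real.exp (-(n * A)) * (√(2 * Real.pi * n) * (2 * Real.pi)⁻¹) *
        |(∫ u, centeredCharFun ν t u ^ n).re -
          √(Real.pi / (n * v / 2)) * Real.exp (-(n * d ^ 2 / (2 * v)))| := by
        rw [← hsq, ← abs_of_nonneg (show 0 ≤ Real.exp (-(n * A)) *
          (√(2 * Real.pi * n) * (2 * Real.pi)⁻¹) by positivity), ← abs_mul]
        congr 1; ring
    _ ≤ 1 * √(n : ℝ) * ∫ u, ‖centeredCharFun ν (t - d) u ^ n -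
          ((Real.exp (-(v / 2) * u ^ 2) : ℝ) : ℂ) ^ n‖ := by
        gcongr
    _ ≤ E n := by rw [one_mul]; exact hEn

end Gap

/-! ### The small gap condition -/

/-- The analytic condition behind both sides of the equivalence: the second derivative of the gap
is uniformly small, from above, wherever the gap is small. -/
def SmallGapCondition (A : ℝ → ℝ) : Prop :=
  ∀ κ > 0, ∃ δ > 0, ∀ t, A t < δ → iteratedDeriv 2 A t < κ

theorem iteratedDeriv_two_nonneg_of_isMinOn {A : ℝ → ℝ} (hA : ContDiff ℝ 2 A) {t : ℝ}
    (hmin : ∀ s, A t ≤ A s) : 0 ≤ iteratedDeriv 2 A t := by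
  by_contra! hneg
  have hd : deriv A t = 0 := IsLocalMin.deriv_eq_zero (Eventually.of_forall hmin)
  have h2 : deriv (deriv A) t < 0 := by
    simpa only [iteratedDeriv_succ, iteratedDeriv_zero] using hneg
  have hmax := isLocalMax_of_deriv_deriv_neg h2 hd hA.continuous.continuousAt
  have hconst : A =ᶠ[𝓝 t] fun _ => A t := by
    filter_upwards [hmax] with s hs using le_antisymm hs (hmin s)
  have : iteratedDeriv 2 A t = 0 := by
    rw [hconst.iteratedDeriv_eq 2]
    simp [iteratedDeriv_const]
  linarith

theorem SmallGapCondition.limsup_le {A : ℝ → ℝ} (h : SmallGapCondition A) {t : ℕ → ℝ}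
    (ht : Tendsto (fun k => A (t k)) atTop (𝓝 0)) :
    limsup (fun k => ((iteratedDeriv 2 A (t k) : ℝ) : EReal)) atTop ≤ 0 := by
  by_contra! hlt
  obtain ⟨κ, h0, h1⟩ := EReal.lt_iff_exists_real_btwn.1 hlt
  obtain ⟨δ, hδ, hA⟩ := h κ (by exact_mod_cast h0)
  refine absurd h1 (not_lt.2 ?_)
  refine limsup_le_of_le (h := ?_)
  filter_upwards [ht.eventually (gt_mem_nhds hδ)] with k hk
  exact_mod_cast (hA _ hk).le

/-- Points violating the small gap condition either accumulate at a zero of `A` or have a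
subsequence tending to `±∞`. -/
theorem smallGapCondition_of_limsup {A : ℝ → ℝ} (hA : ContDiff ℝ 2 A) (h0 : ∀ t, 0 ≤ A t)
    (ha : ∀ t, A t = 0 → iteratedDeriv 2 A t = 0)
    (hb : ∀ t : ℕ → ℝ, (Tendsto t atTop atTop ∨ Tendsto t atTop atBot) →
      Tendsto (fun k => A (t k)) atTop (𝓝 0) →
      limsup (fun k => ((iteratedDeriv 2 A (t k) : ℝ) : EReal)) atTop ≤ 0) :
    SmallGapCondition A := by
  intro κ hκ
  by_contra! hcon
  choose t ht1 ht2 using fun k : ℕ => hcon (1 / ((k : ℝ) + 1)) (by positivity)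
  have hlim : Tendsto (fun k => A (t k)) atTop (𝓝 0) :=
    squeeze_zero (fun k => h0 _) (fun k => (ht1 k).le) tendsto_one_div_add_atTop_nhds_zero_nat
  have hno : ∀ φ : ℕ → ℕ, StrictMono φ →
      ¬ (Tendsto (t ∘ φ) atTop atTop ∨ Tendsto (t ∘ φ) atTop atBot) := by
    intro φ hφ htt
    have h := hb (t ∘ φ) htt (hlim.comp hφ.tendsto_atTop)
    have h' : (κ : EReal) ≤
        limsup (fun k => ((iteratedDeriv 2 A ((t ∘ φ) k) : ℝ) : EReal)) atTop := by
      refine le_limsup_of_frequently_le (Eventually.of_forall fun k => ?_).frequently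
      exact_mod_cast ht2 (φ k)
    have h'' : (κ : EReal) ≤ 0 := h'.trans h
    have : κ ≤ 0 := by exact_mod_cast h''
    linarith
  by_cases hbd : ∃ R : ℝ, ∃ᶠ k in atTop, t k ∈ Metric.closedBall (0 : ℝ) R
  · obtain ⟨R, hR⟩ := hbd
    obtain ⟨a, -, φ, hφ, hta⟩ :=
      tendsto_subseq_of_frequently_bounded Metric.isBounded_closedBall hR
    have e1 : A a = 0 :=
      tendsto_nhds_unique ((hA.continuous.tendsto a).comp hta) (hlim.comp hφ.tendsto_atTop)
    have e2 : κ ≤ iteratedDeriv 2 A a :=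
      ge_of_tendsto (((hA.continuous_iteratedDeriv 2 (by norm_num)).tendsto a).comp hta)
        (Eventually.of_forall fun k => ht2 (φ k))
    rw [ha a e1] at e2
    linarith
  · push Not at hbd
    have habs : Tendsto (fun k => |t k|) atTop atTop := by
      refine tendsto_atTop.2 fun R => ?_
      filter_upwards [hbd R] with k hk
      simp only [Metric.mem_closedBall, dist_zero_right, Real.norm_eq_abs, not_le] at hk
      exact hk.le
    by_cases hpos : ∃ᶠ k in atTop, 0 ≤ t k
    · obtain ⟨φ, hφ, hp⟩ := extraction_of_frequently_atTop hpos
      refine hno φ hφ (Or.inl ((habs.comp hφ.tendsto_atTop).congr fun k => ?_))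
      simp [abs_of_nonneg (hp k)]
    · rw [not_frequently] at hpos
      refine hno id strictMono_id (Or.inr ?_)
      have := tendsto_neg_atTop_atBot.comp habs
      refine this.congr' ?_
      filter_upwards [hpos] with k hk
      simp [abs_of_neg (not_le.1 hk)]

section Ratio

variable {μ : Measure ℝ} [IsProbabilityMeasure μ]

/-- The upper bound for the ratio: the local limit theorem where the gap is small, exponential decay
elsewhere. -/
theorem eventually_densityRatio_le (hI : ∀ t : ℝ, Integrable (fun x => Real.exp (t * x)) μ)
    (hA : ∀ t, 0 ≤ logLaplaceGap id μ t) {C : ℝ} {m : ℕ} (hm : 1 ≤ m) (hC : 0 ≤ C)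
    (hD : convPow μ m ≤ ENNReal.ofReal C • gaussianReal 0 m)
    (hU : SmallGapCondition (logLaplaceGap id μ)) {ε : ℝ} (hε : 0 < ε) :
    ∀ᶠ n in atTop, ∀ t, densityRatio μ n t ≤ 1 + ε := by
  obtain ⟨v₀, hv₀, E, hE, hmain⟩ := exists_densityRatio_sub_le hI hA hm hC hD
  -- chosen so that the variance `1 - κ` corresponds to the ratio `1 + ε / 2`
  set κ : ℝ := 1 - ((1 + ε / 2)⁻¹) ^ 2 with hκ
  have hinv : (1 + ε / 2)⁻¹ < 1 := inv_lt_one_of_one_lt₀ (by linarith)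
  have hinv0 : 0 < (1 + ε / 2)⁻¹ := by positivity
  obtain ⟨δ, hδ, hδA⟩ := hU κ (by rw [hκ]; nlinarith)
  have hfar : Tendsto (fun n : ℕ => √(2 * Real.pi) * C *
      (√n * Real.exp (-(min δ 1)) ^ (n - m))) atTop (𝓝 0) := by
    have := (tendsto_sqrt_mul_pow_sub (Real.exp_pos (-(min δ 1)))
      (Real.exp_lt_one_iff.2 (by have : 0 < min δ 1 := by positivity
                                 linarith)) m).const_mul (√(2 * Real.pi) * C)
    simpa using this
  filter_upwards [eventually_ge_atTop (2 * m), hE.eventually (gt_mem_nhds (half_pos hε)),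
    hfar.eventually (gt_mem_nhds one_pos)] with n hn hEn hfn t
  rcases lt_or_ge (logLaplaceGap id μ t) (min δ 1) with ht | ht
  · obtain ⟨hv, hR⟩ := hmain t (ht.le.trans (min_le_right _ _))
    have hR := (abs_le.1 (hR n hn)).2
    have h2 := hδA t (ht.trans_le (min_le_left _ _))
    set v := 1 - iteratedDeriv 2 (logLaplaceGap id μ) t
    have hsv : (1 + ε / 2)⁻¹ ≤ √v := by
      apply Real.le_sqrt_of_sq_le
      simp only [hκ] at h2
      linarith
    have h3 : (√v)⁻¹ ≤ 1 + ε / 2 := by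
      rw [← inv_inv (1 + ε / 2)]
      gcongr
    have hn0 : (0 : ℝ) ≤ n := by positivity
    have hv0 : 0 < v := hv₀.trans_le hv
    have h4 : Real.exp (-(n * logLaplaceGap id μ t)) ≤ 1 :=
      Real.exp_le_one_iff.2 (by have := mul_nonneg hn0 (hA t); linarith)
    have h5 : Real.exp (-(n * deriv (logLaplaceGap id μ) t ^ 2 / (2 * v))) ≤ 1 :=
      Real.exp_le_one_iff.2 (by
        have : 0 ≤ n * deriv (logLaplaceGap id μ) t ^ 2 / (2 * v) := by positivity
        linarith)
    have h6 : Real.exp (-(n * logLaplaceGap id μ t)) * ((√v)⁻¹ *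
        Real.exp (-(n * deriv (logLaplaceGap id μ) t ^ 2 / (2 * v)))) ≤
        1 * ((1 + ε / 2) * 1) := by gcongr
    linarith
  · refine (densityRatio_le hI hm hC hD hn t).trans ?_
    have hmn : (m : ℝ) ≤ n := by exact_mod_cast (by omega : m ≤ n)
    have h1 : Real.exp (-((n - m) * logLaplaceGap id μ t)) ≤
        Real.exp (-(min δ 1)) ^ (n - m) := by
      rw [← Real.exp_nat_mul, Nat.cast_sub (by omega)]
      apply Real.exp_le_exp.2
      have := mul_le_mul_of_nonneg_left ht (sub_nonneg.2 hmn)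
      linarith
    calc _ ≤ √(2 * Real.pi * n) * (C * Real.exp (-(min δ 1)) ^ (n - m)) := by gcongr
      _ = √(2 * Real.pi) * C * (√n * Real.exp (-(min δ 1)) ^ (n - m)) := by
        rw [Real.sqrt_mul (by positivity)]; ring
      _ ≤ 1 + ε := by linarith

/-- If `A''` stayed above `κ` at points where `A` is arbitrarily small, then for one fixed large `n`
the ratio would come close to `(1 - κ) ^ (-1/2) > 1` there. -/
theorem smallGapCondition_of_densityRatio_le
    (hI : ∀ t : ℝ, Integrable (fun x => Real.exp (t * x)) μ)
    (hA : ∀ t, 0 ≤ logLaplaceGap id μ t) {C : ℝ} {m : ℕ} (hm : 1 ≤ m) (hC : 0 ≤ C)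
    (hD : convPow μ m ≤ ENNReal.ofReal C • gaussianReal 0 m)
    (h : ∀ ε > 0, ∀ᶠ n in atTop, ∀ t, densityRatio μ n t ≤ 1 + ε) :
    SmallGapCondition (logLaplaceGap id μ) := by
  obtain ⟨v₀, hv₀, E, hE, hmain⟩ := exists_densityRatio_sub_le hI hA hm hC hD
  intro κ hκ
  rcases le_or_gt 1 κ with hκ1 | hκ1
  · -- the variance of a tilted law is bounded below by `v₀ > 0`
    refine ⟨1, one_pos, fun t ht => ?_⟩
    have := (hmain t ht.le).1
    linarith
  set q : ℝ := (√(1 - κ))⁻¹ with hq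
  have hs0 : 0 < √(1 - κ) := Real.sqrt_pos.2 (by linarith)
  have hq1 : 1 < q := by
    refine (one_lt_inv₀ hs0).2 ?_
    rw [Real.sqrt_lt' one_pos]; linarith
  have hε : 0 < (q - 1) / 3 := by linarith
  -- this `n` stays fixed while the gap tends to zero
  obtain ⟨n, hn, hEn, hRn⟩ := ((eventually_ge_atTop (2 * m)).and
    ((hE.eventually (gt_mem_nhds hε)).and (h _ hε))).exists
  have hcont : Tendsto (fun δ : ℝ => Real.exp (-(n * δ)) * (q * Real.exp (-(n * δ / v₀))))
      (𝓝 0) (𝓝 q) := by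
    have : Continuous fun δ : ℝ => Real.exp (-(n * δ)) * (q * Real.exp (-(n * δ / v₀))) := by
      fun_prop
    simpa using this.tendsto 0
  have hev := hcont.eventually (lt_mem_nhds (show 1 + 2 * ((q - 1) / 3) < q by linarith))
  obtain ⟨r, hr, hball⟩ := Metric.eventually_nhds_iff.1 hev
  refine ⟨min r 1, by positivity, fun t ht => ?_⟩
  by_contra! hκt
  have hA0 := hA t
  have htr : logLaplaceGap id μ t < r := ht.trans_le (min_le_left _ _)
  have hb := hball (y := logLaplaceGap id μ t) (by
    rwa [Real.dist_eq, sub_zero, abs_of_nonneg hA0])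
  obtain ⟨hv, hR⟩ := hmain t (ht.le.trans (min_le_right _ _))
  have hR := (abs_le.1 (hR n hn)).1
  have hd := deriv_logLaplaceGap_sq_le hI hA t
  have hRt := hRn t
  set v := 1 - iteratedDeriv 2 (logLaplaceGap id μ) t with hvdef
  have hv0 : 0 < v := hv₀.trans_le hv
  have h1 : q ≤ (√v)⁻¹ := by
    have : 0 < √v := Real.sqrt_pos.2 hv0
    rw [hq]
    gcongr
    linarith
  have h2 : n * deriv (logLaplaceGap id μ) t ^ 2 / (2 * v) ≤ n * logLaplaceGap id μ t / v₀ := by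
    calc _ ≤ n * (2 * logLaplaceGap id μ t) / (2 * v) := by gcongr
      _ = n * logLaplaceGap id μ t / v := by field_simp
      _ ≤ _ := by gcongr
  have h3 : Real.exp (-(n * logLaplaceGap id μ t)) *
      (q * Real.exp (-(n * logLaplaceGap id μ t / v₀))) ≤
      Real.exp (-(n * logLaplaceGap id μ t)) * ((√v)⁻¹ *
        Real.exp (-(n * deriv (logLaplaceGap id μ) t ^ 2 / (2 * v)))) := by
    gcongr
  linarith

end Ratio

/-! ### The Tsallis distance of normalized sums -/

theorem tsallisInf_le_coe_iff {p : ℝ → ℝ} {c : ℝ} :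
    tsallisInf p ≤ (c : EReal) ↔ ∀ᵐ x, p x ≤ (1 + c) * gaussianPDFReal 0 1 x := by
  have hpt : ∀ x, ((((p x - gaussianPDFReal 0 1 x) / gaussianPDFReal 0 1 x : ℝ) : EReal) ≤ c ↔
      p x ≤ (1 + c) * gaussianPDFReal 0 1 x) := by
    intro x
    have := gaussianPDFReal_pos 0 1 x one_ne_zero
    rw [EReal.coe_le_coe_iff, div_le_iff₀ this]
    constructor <;> intro h <;> linarith
  constructor
  · intro h
    filter_upwards [ae_le_essSup (μ := (volume : Measure ℝ)) (f := fun x : ℝ =>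
      (((p x - gaussianPDFReal 0 1 x) / gaussianPDFReal 0 1 x : ℝ) : EReal))] with x hx
    exact (hpt x).1 (hx.trans h)
  · intro h
    refine essSup_le_of_ae_le _ ?_
    filter_upwards [h] with x hx using (hpt x).2 hx

/-- A bound for the Tsallis distance is a domination by a multiple of the normal law. -/
theorem map_le_smul_gaussianReal {Ω' : Type*} [MeasurableSpace Ω'] {P' : Measure Ω'}
    [IsProbabilityMeasure P'] {Z : Ω' → ℝ} (hZ : HasPDF Z P' volume) {c : ℝ}
    (h : tsallisInf (realDensity Z P') ≤ (c : EReal)) :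
    P'.map Z ≤ ENNReal.ofReal (1 + c) • gaussianReal 0 1 := by
  have h := tsallisInf_le_coe_iff.1 h
  rw [map_eq_withDensity_pdf Z P' volume, gaussianReal_of_var_ne_zero _ one_ne_zero,
    ← withDensity_smul _ (measurable_gaussianPDF 0 1)]
  refine withDensity_mono ?_
  filter_upwards [h, (pdf.ae_lt_top : ∀ᵐ x, pdf Z P' volume x < ⊤)] with x hx hx2
  rw [realDensity] at hx
  rw [Pi.smul_apply, smul_eq_mul, gaussianPDF,
    ← ENNReal.ofReal_mul' (gaussianPDFReal_nonneg 0 1 x)]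
  rw [← ENNReal.ofReal_toReal hx2.ne]
  exact ENNReal.ofReal_le_ofReal hx

/-- Otherwise the density would be at most `(1 + c) φ` with `c < 0`, of integral less than `1`. -/
theorem tsallisInf_realDensity_nonneg {Ω' : Type*} [MeasurableSpace Ω'] {P' : Measure Ω'}
    [IsProbabilityMeasure P'] {Z : Ω' → ℝ} (hZ : HasPDF Z P' volume) :
    0 ≤ tsallisInf (realDensity Z P') := by
  by_contra! hlt
  obtain ⟨c, h1, h2⟩ := EReal.lt_iff_exists_real_btwn.1 hlt
  have hc : c < 0 := by exact_mod_cast h2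
  have h := map_le_smul_gaussianReal hZ h1.le Set.univ
  rw [Measure.map_apply_of_aemeasurable hZ.aemeasurable MeasurableSet.univ] at h
  simp only [Set.preimage_univ, measure_univ, Measure.smul_apply, smul_eq_mul, mul_one] at h
  rw [ENNReal.one_le_ofReal] at h
  linarith

theorem convPow_le_smul_gaussianReal {μ : Measure ℝ} {m : ℕ} (hm : 1 ≤ m) {C : ENNReal}
    (h : (convPow μ m).map (fun x => x / √m) ≤ C • gaussianReal 0 1) :
    convPow μ m ≤ C • gaussianReal 0 m := by
  have hm0 : (0 : ℝ) < m := by exact_mod_cast hm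
  have hs : √(m : ℝ) ≠ 0 := (Real.sqrt_pos.2 hm0).ne'
  have h2 := Measure.map_mono h (show Measurable fun x : ℝ => √m * x by fun_prop)
  rw [Measure.map_map (by fun_prop) (by fun_prop), Measure.map_smul,
    gaussianReal_map_const_mul] at h2
  have e1 : (fun x : ℝ => √m * x) ∘ (fun x => x / √m) = id := by
    ext x; simp only [Function.comp, id]; field_simp
  rw [e1, Measure.map_id] at h2
  convert h2 using 3
  · simp
  · ext; simp

theorem fourierDensity_nonneg {ρ : Measure ℝ} [IsFiniteMeasure ρ] (hac : ρ ≪ volume)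
    (h : Integrable (charFun ρ)) (x : ℝ) : 0 ≤ fourierDensity ρ x := by
  have hc := continuous_fourierDensity h
  have hae : fourierDensity ρ =ᵐ[volume] fun x => max (fourierDensity ρ x) 0 := by
    filter_upwards [rnDeriv_ae_eq_fourierDensity hac h] with x hx
    rw [max_eq_left]
    rw [← hx]; exact ENNReal.toReal_nonneg
  have := congrFun ((Continuous.ae_eq_iff_eq volume hc (hc.max continuous_const)).1 hae) x
  rw [this]; exact le_max_right _ _

theorem eq_withDensity_fourierDensity {ρ : Measure ℝ} [IsFiniteMeasure ρ] (hac : ρ ≪ volume)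
    (h : Integrable (charFun ρ)) :
    ρ = volume.withDensity fun x => ENNReal.ofReal (fourierDensity ρ x) := by
  conv_lhs => rw [← Measure.withDensity_rnDeriv_eq ρ volume hac]
  refine withDensity_congr_ae ?_
  filter_upwards [rnDeriv_ae_eq_fourierDensity hac h, Measure.rnDeriv_lt_top ρ volume]
    with x hx hx2
  rw [← hx, ENNReal.ofReal_toReal hx2.ne]

theorem map_div_eq_withDensity_fourierDensity {ρ : Measure ℝ} [IsFiniteMeasure ρ]
    (hac : ρ ≪ volume) (h : Integrable (charFun ρ)) {a : ℝ} (ha : 0 < a) :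
    ρ.map (fun x => x / a) =
      volume.withDensity fun x => ENNReal.ofReal (a * fourierDensity ρ (a * x)) := by
  have hc := continuous_fourierDensity h
  refine Measure.ext_of_lintegral _ fun f hf => ?_
  rw [lintegral_map hf (by fun_prop)]
  conv_lhs => rw [eq_withDensity_fourierDensity hac h]
  rw [lintegral_withDensity_eq_lintegral_mul _ (by fun_prop) (by fun_prop),
    lintegral_withDensity_eq_lintegral_mul _ (by fun_prop) (by fun_prop)]
  conv_lhs => rw [← Real.smul_map_volume_mul_left ha.ne']
  rw [lintegral_smul_measure, lintegral_map (by fun_prop) (by fun_prop), smul_eq_mul,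
    ← lintegral_const_mul _ (by fun_prop)]
  congr 1; ext x
  simp only [Pi.mul_apply]
  rw [mul_div_cancel_left₀ x ha.ne', ENNReal.ofReal_mul ha.le, abs_of_pos ha, mul_assoc]

/-- The left side is the density of the normalized sum at `x`. -/
theorem sqrt_mul_fourierDensity_eq (μ : Measure ℝ) {n : ℕ} (hn : 1 ≤ n) (x : ℝ) :
    √n * fourierDensity (convPow μ n) (√n * x) =
      densityRatio μ n (x / √n) * gaussianPDFReal 0 1 x := by
  have hn0 : (0 : ℝ) < n := by exact_mod_cast hn
  have hs : 0 < √(n : ℝ) := Real.sqrt_pos.2 hn0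
  have hss : √(n : ℝ) ^ 2 = n := Real.sq_sqrt hn0.le
  have e1 : (n : ℝ) * (x / √n) = √n * x := by
    rw [mul_div_assoc', div_eq_iff hs.ne']
    linear_combination (-x) * hss
  have e2 : (n : ℝ) * (x / √n) ^ 2 / 2 = x ^ 2 / 2 := by
    rw [div_pow, hss]; field_simp
  have hp : √(2 * Real.pi) ≠ 0 := by positivity
  rw [densityRatio, e1, e2, gaussianPDFReal, Real.sqrt_mul (by positivity)]
  have e3 : Real.exp (x ^ 2 / 2) * Real.exp (-(x - 0) ^ 2 / (2 * ((1 : ℝ≥0) : ℝ))) = 1 := by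
    rw [← Real.exp_add, Real.exp_eq_one_iff]
    push_cast; ring
  have e4 : √(2 * Real.pi * ((1 : ℝ≥0) : ℝ)) = √(2 * Real.pi) := by simp
  rw [e4]
  calc _ = √n * fourierDensity (convPow μ n) (√n * x) * (√(2 * Real.pi) * (√(2 * Real.pi))⁻¹) *
        (Real.exp (x ^ 2 / 2) * Real.exp (-(x - 0) ^ 2 / (2 * ((1 : ℝ≥0) : ℝ)))) := by
        rw [e3, mul_inv_cancel₀ hp]; ring
    _ = _ := by ring

theorem forall_le_of_ae_le {f g : ℝ → ℝ} (hf : Continuous f) (hg : Continuous g)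
    (h : ∀ᵐ x, f x ≤ g x) (x : ℝ) : f x ≤ g x := by
  have := (Continuous.ae_eq_iff_eq volume (hf.max hg) hg).1 (by
    filter_upwards [h] with y hy using max_eq_right hy)
  rw [← congrFun this x]
  exact le_max_left _ _

/-- For a variable `Z` distributed as a normalized sum, the Tsallis distance is the supremum of
`densityRatio - 1`. -/
theorem hasPDF_and_tsallisInf_le_iff {Ω' : Type*} [MeasurableSpace Ω'] {P' : Measure Ω'}
    [IsProbabilityMeasure P'] {Z : Ω' → ℝ} (hZ : AEMeasurable Z P') {μ : Measure ℝ}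
    [IsProbabilityMeasure μ] {n : ℕ} (hn : 1 ≤ n)
    (hlaw : P'.map Z = (convPow μ n).map (fun x => x / √n)) (hac : convPow μ n ≪ volume)
    (hi : Integrable (charFun (convPow μ n))) :
    HasPDF Z P' volume ∧ ∀ c : ℝ, tsallisInf (realDensity Z P') ≤ (c : EReal) ↔
      ∀ t, densityRatio μ n t ≤ 1 + c := by
  have hn0 : (0 : ℝ) < n := by exact_mod_cast hn
  have hs : 0 < √(n : ℝ) := Real.sqrt_pos.2 hn0
  have hc := continuous_fourierDensity hi
  have hmap := map_div_eq_withDensity_fourierDensity hac hi hs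
  rw [← hlaw] at hmap
  have hpdf : HasPDF Z P' volume := by
    refine hasPDF_of_map_eq_withDensity hZ _ (by fun_prop) hmap
  refine ⟨hpdf, fun c => ?_⟩
  have hden : ∀ᵐ x, realDensity Z P' x = √n * fourierDensity (convPow μ n) (√n * x) := by
    have : pdf Z P' volume =ᵐ[volume]
        fun x => ENNReal.ofReal (√n * fourierDensity (convPow μ n) (√n * x)) := by
      rw [pdf, hmap]
      exact Measure.rnDeriv_withDensity _ (by fun_prop)
    filter_upwards [this] with x hx
    rw [realDensity, hx, ENNReal.toReal_ofReal]
    exact mul_nonneg hs.le (fourierDensity_nonneg hac hi _)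
  rw [tsallisInf_le_coe_iff]
  have hφ := fun x => gaussianPDFReal_pos 0 1 x one_ne_zero
  constructor
  · intro h t
    have h' : ∀ᵐ x, √n * fourierDensity (convPow μ n) (√n * x) ≤
        (1 + c) * gaussianPDFReal 0 1 x := by
      filter_upwards [h, hden] with x h1 h2
      rwa [← h2]
    have hcg : Continuous (gaussianPDFReal 0 1) := by
      unfold gaussianPDFReal; fun_prop
    have := forall_le_of_ae_le (by fun_prop) (by fun_prop) h' (√n * t)
    rw [sqrt_mul_fourierDensity_eq μ hn, mul_div_cancel_left₀ t hs.ne'] at this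
    exact le_of_mul_le_mul_right this (hφ _)
  · intro h
    filter_upwards [hden] with x hx
    rw [hx, sqrt_mul_fourierDensity_eq μ hn]
    exact mul_le_mul_of_nonneg_right (h _) (hφ x).le

theorem map_normalizedSum_eq {Ω' : Type*} [MeasurableSpace Ω'] {P' : Measure Ω'}
    [IsProbabilityMeasure P'] {ξ : ℕ → Ω' → ℝ} (hindep : iIndepFun ξ P')
    (hm : ∀ k, AEMeasurable (ξ k) P') {μ : Measure ℝ} (hμ : ∀ k, P'.map (ξ k) = μ) (n : ℕ) :
    P'.map (normalizedSum ξ n) = (convPow μ n).map (fun x => x / √n) := by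
  rw [← map_sum_range_eq_convPow hindep hm hμ n, AEMeasurable.map_map_of_aemeasurable (by fun_prop)
    (Finset.aemeasurable_fun_sum _ fun k _ => hm k)]
  rfl

theorem logLaplaceGap_id_map {Ω : Type*} [MeasurableSpace Ω] {P : Measure Ω} {X : Ω → ℝ}
    (hX : AEMeasurable X P) : logLaplaceGap id (P.map X) = logLaplaceGap X P := by
  ext t
  simp only [logLaplaceGap, cgf, mgf_id_map hX]

theorem theorem2p1 {Ω Ω' : Type*} [MeasurableSpace Ω] [MeasurableSpace Ω']
    (P : Measure Ω) [IsProbabilityMeasure P] (P' : Measure Ω') [IsProbabilityMeasure P']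
    (X : Ω → ℝ) (hX : AEMeasurable X P) (hmean : ∫ ω, X ω ∂P = 0) (hvar : variance X P = 1)
    (hsub : StrictlySubgaussian X P)
    (ξ : ℕ → Ω' → ℝ) (hindep : iIndepFun ξ P') (hcopy : ∀ k, IdentDistrib (ξ k) X P' P)
    (hfin : ∃ n : ℕ, 1 ≤ n ∧ HasPDF (normalizedSum ξ n) P' volume ∧
      tsallisInf (realDensity (normalizedSum ξ n) P') < ⊤) :
    ((∀ᶠ n : ℕ in atTop, HasPDF (normalizedSum ξ n) P' volume) ∧
      Tendsto (fun n : ℕ => tsallisInf (realDensity (normalizedSum ξ n) P')) atTop (𝓝 0)) ↔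
    ((∀ t : ℝ, logLaplaceGap X P t = 0 → iteratedDeriv 2 (logLaplaceGap X P) t = 0) ∧
      (∀ t : ℕ → ℝ, (Tendsto t atTop atTop ∨ Tendsto t atTop atBot) →
        Tendsto (fun k => logLaplaceGap X P (t k)) atTop (𝓝 0) →
        limsup (fun k => ((iteratedDeriv 2 (logLaplaceGap X P) (t k) : ℝ) : EReal)) atTop ≤ 0)) := by
  set μ := P.map X with hμ
  have hprob : IsProbabilityMeasure μ := Measure.isProbabilityMeasure_map hX
  have hξm : ∀ k, AEMeasurable (ξ k) P' := fun k => (hcopy k).aemeasurable_fst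
  have hξ : ∀ k, P'.map (ξ k) = μ := fun k => (hcopy k).map_eq
  have hI : ∀ t : ℝ, Integrable (fun x => Real.exp (t * x)) μ := by
    intro t
    rw [hμ, integrable_map_measure (by fun_prop) hX]
    exact hsub.integrable_exp_mul t
  rw [← logLaplaceGap_id_map hX, ← hμ]
  have hA : ∀ t, 0 ≤ logLaplaceGap id μ t := by
    intro t
    have h := hsub.mgf_le t
    rw [hvar, ← mgf_id_map hX, ← hμ, mgf_id_eq_exp_sub_gap hI, Real.exp_le_exp] at h
    simp at h
    linarith
  obtain ⟨m, hm, hpdfm, hTm⟩ := hfin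
  obtain ⟨c, hc, -⟩ := EReal.lt_iff_exists_real_btwn.1 hTm
  have hlaw := map_normalizedSum_eq hindep hξm hξ
  obtain ⟨C, hC, hD⟩ : ∃ C : ℝ, 0 ≤ C ∧ convPow μ m ≤ ENNReal.ofReal C • gaussianReal 0 m := by
    refine ⟨max (1 + c) 0, le_max_right _ _, convPow_le_smul_gaussianReal hm ?_⟩
    rw [← hlaw, ENNReal.ofReal_max]
    simpa using map_le_smul_gaussianReal hpdfm hc.le
  have hZm : ∀ n, AEMeasurable (normalizedSum ξ n) P' := fun n =>
    (Finset.aemeasurable_fun_sum _ fun k _ => hξm k).div_const _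
  have hkey : ∀ n, 2 * m ≤ n → HasPDF (normalizedSum ξ n) P' volume ∧
      ∀ c : ℝ, tsallisInf (realDensity (normalizedSum ξ n) P') ≤ (c : EReal) ↔
        ∀ t, densityRatio μ n t ≤ 1 + c := fun n hn =>
    hasPDF_and_tsallisInf_le_iff (hZm n) (by omega) (hlaw n)
      (convPow_absolutelyContinuous_of_le_gaussian hm hD (by omega))
      (integrable_charFun_convPow hI hm hC hD hn)
  constructor
  · rintro ⟨-, hT⟩
    have hU : SmallGapCondition (logLaplaceGap id μ) := by
      refine smallGapCondition_of_densityRatio_le hI hA hm hC hD fun ε hε => ?_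
      filter_upwards [eventually_ge_atTop (2 * m),
        hT.eventually (gt_mem_nhds (show (0 : EReal) < (ε : EReal) by exact_mod_cast hε))]
        with n hn hlt
      exact ((hkey n hn).2 ε).1 hlt.le
    refine ⟨fun t ht => le_antisymm ?_ ?_, fun t _ ht => hU.limsup_le ht⟩
    · refine le_of_forall_pos_lt_add fun κ hκ => ?_
      obtain ⟨δ, hδ, h⟩ := hU κ hκ
      rw [zero_add]
      exact h t (by rwa [ht])
    · exact iteratedDeriv_two_nonneg_of_isMinOn (contDiff_logLaplaceGap_id hI)
        fun s => by rw [ht]; exact hA s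
  · rintro ⟨ha, hb⟩
    have hU := smallGapCondition_of_limsup (contDiff_logLaplaceGap_id hI) hA ha hb
    refine ⟨?_, tendsto_order.2 ⟨fun a ha => ?_, fun a ha => ?_⟩⟩
    · filter_upwards [eventually_ge_atTop (2 * m)] with n hn using (hkey n hn).1
    · filter_upwards [eventually_ge_atTop (2 * m)] with n hn
      exact ha.trans_le (tsallisInf_realDensity_nonneg (hkey n hn).1)
    · obtain ⟨ε, h0, h1⟩ := EReal.lt_iff_exists_real_btwn.1 ha
      filter_upwards [eventually_ge_atTop (2 * m), eventually_densityRatio_le hI hA hm hC hD hU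
        (show 0 < ε by exact_mod_cast h0)] with n hn h
      exact (((hkey n hn).2 ε).2 h).trans_lt h1
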